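/- **Model.** There are $N$ databases, each storing the same $M\ge 1$ messages $W_1,\dots,W_M$, which are independent and uniform on $\mathbb F_2^L$. To retrieve $W_i$, the user draws queries $Q_1^{[i]},\dots,Q_N^{[i]}$ independently of the messages. Database $n$ answers with a string $A_n^{[i]}$ of length $t_n$ that is a function of $Q_n^{[i]}$ and $W_1,\dots,W_M$; the user receives this string through a discrete memoryless channel $p(y_n|x_n)$ with finite alphabets and capacity $C_n=\max_{p(x_n)}I(X_n;Y_n)$ (in bits), the $N$ channels being independent. A scheme is *private* if for every $n$ the joint law of $(Q_n^{[i]},A_n^{[i]},W_{1:M})$ does not depend on $i$. A rate $R$ is *achievable with traffic ratios* $\tau=(\tau_1,\dots,\tau_N)$, where $\tau_n\ge 0$ and $\sum_n\tau_n=1$, if there are private schemes, one for each message length $L$, such that as $L\to\infty$ the probability of decoding $W_i$ wrongly from all queries and all noisy answers tends to $0$ for each $i$, $t_n/\sum_j t_j\to\tau_n$ for each $n$, and $L/\sum_n t_n\to R$. The capacity $C_{\mathrm{PIR}}(\mathbf C)$ is the supremum of all rates that are achievable with some traffic ratios. **Stage counts.** Let $\mathbf n=(n_0\le n_1\le\dots\le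 n_{M-1})$ be a sequence in $\{1,\dots,N\}$. Put $n_{-1}=0$, $\mathcal S=\{\ell\ge 0: n_\ell>n_{\ell-1}\}$, and $\xi_\ell=\prod_{s\in\mathcal S\setminus\{\ell\}}\binom{M-2}{s-1}$, where the factor of $s=0$ is understood to be $1$ here and below. For $\ell\in\mathcal S$ define $y_\ell[k]$, $1\le k\le M$, by $y_0[1]=\prod_{s\in\mathcal S}\binom{M-2}{s-1}$, by $y_\ell[k]=0$ for $k\le\ell$, and for $k\ge 2$, $k>\ell$ by $$y_\ell[k]=n_0\,\xi_\ell\,\delta[k-\ell-1]\,\mathbf 1_{\{\ell\ge 2\}}+(n_\ell-n_{\ell-1}-1)\,y_\ell[k-1]+\sum_{j\in\mathcal S\setminus\{\ell\}}(n_j-n_{j-1})\,y_j[k-1],$$ where $\delta[0]=1$ and $\delta[m]=0$ for $m\neq0$. Let $D_\ell=\sum_{k=1}^M\binom Mk y_\ell[k]$. **Theorem (Lower bound).** If $C_n>0$ for all $n\le n_{M-1}$, then the rate $$R(\mathbf n,\mathbf C)=\frac{\sum_{\ell\in\mathcal S}\sum_{k=1}^M\binom{M-1}{k-1}y_\ell[k]\,(n_\ell-n_{\ell-1})}{\sum_{\ell\in\mathcal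 S}\sum_{n=n_{\ell-1}+1}^{n_\ell}D_\ell/C_n}$$ is achievable, with traffic ratios $\tau_n$ proportional to $D_\ell/C_n$ for $n_{\ell-1}<n\le n_\ell$, $\ell\in\mathcal S$, and $\tau_n=0$ for $n>n_{M-1}$. Consequently $$C_{\mathrm{PIR}}(\mathbf C)\ \ge\ \max_{n_0\le\dots\le n_{M-1}}R(\mathbf n,\mathbf C),$$ where the maximum is over all such sequences with $C_n>0$ for all $n\le n_{M-1}$ (and is read as $0$ if there are none). -/

import Mathlib

universe u v

namespace NPIR

/-! ### Discrete memoryless channels -/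

/-- A discrete channel with input alphabet `X` and output alphabet `Y`;
`prob x y` is the transition probability `p(y | x)`. -/
structure Channel (X : Type u) (Y : Type v) [Fintype Y] where
  prob : X → Y → ℝ
  prob_nonneg : ∀ x y, 0 ≤ prob x y
  prob_sum : ∀ x, ∑ y, prob x y = 1

/-- The mutual information `I(X;Y)` in bits, for the input distribution `p`.
Terms of zero probability contribute zero. -/
noncomputable def Channel.mutualInfo {X : Type u} {Y : Type v} [Fintype X] [Fintype Y]
    (W : Channel X Y) (p : X → ℝ) : ℝ :=
  ∑ x, ∑ y, p x * W.prob x y * Real.logb 2 (W.prob x y / ∑ x', p x' * W.prob x' y)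

/-- The channel capacity in bits per channel use, the maximum of the mutual information over all
input distributions. -/
noncomputable def Channel.capacity {X : Type u} {Y : Type v} [Fintype X] [Fintype Y]
    (W : Channel X Y) : ℝ :=
  sSup (W.mutualInfo '' stdSimplex ℝ X)

/-! ### Retrieval schemes -/

/-- The contents of the databases: `M` messages of `L` bits each. -/
abbrev Messages (M L : ℕ) : Type := Fin M → Fin L → ZMod 2

/-- A retrieval scheme for `M` messages of length `L` and `N` databases, where database `n`
answers with a string over the input alphabet `X n` and the user sees a string over `Y n`. -/
structure Scheme (M L : ℕ) {N : ℕ} (X : Fin N → Type u) (Y : Fin N → Type v) where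
  /-- the possible queries to database `n` -/
  Query : Fin N → Type
  [fintypeQuery : ∀ n, Fintype (Query n)]
  /-- `queryProb i` is the joint distribution of the `N` queries when message `i` is desired -/
  queryProb : Fin M → (∀ n, Query n) → ℝ
  queryProb_nonneg : ∀ i q, 0 ≤ queryProb i q
  queryProb_sum : ∀ i, ∑ q, queryProb i q = 1
  /-- the length `t n` of the answer string of database `n` -/
  length : Fin N → ℕ
  /-- the answer string, a function of the query to database `n` and of the messages -/
  answer : ∀ n, Query n → Messages M L → Fin (length n) → X n
  /-- the user's estimate of message `i` from all queries and all noisy answer strings -/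
  decode : Fin M → (∀ n, Query n) → (∀ n, Fin (length n) → Y n) → Fin L → ZMod 2

attribute [instance] Scheme.fintypeQuery

namespace Scheme

variable {M L N : ℕ} {X : Fin N → Type u} {Y : Fin N → Type v}

/-- The joint probability of messages and queries: the messages are independent and uniform, and
the queries are independent of the messages. -/
noncomputable def jointProb (S : Scheme M L X Y) (i : Fin M) (_w : Messages M L)
    (q : ∀ n, S.Query n) : ℝ :=
  (Fintype.card (Messages M L) : ℝ)⁻¹ * S.queryProb i q

open Classical in
/-- The probability that database `n` gets the query `qn`, gives the answer `a`, and the messages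
are `w`, when message `i` is desired. -/
noncomputable def localProb (S : Scheme M L X Y) (i : Fin M) (n : Fin N) (qn : S.Query n)
    (a : Fin (S.length n) → X n) (w : Messages M L) : ℝ :=
  ∑ q with q n = qn ∧ S.answer n (q n) w = a, S.jointProb i w q

/-- Privacy: for every database, the joint law of its query, its answer and the messages does not
depend on the index of the desired message. -/
def IsPrivate (S : Scheme M L X Y) : Prop :=
  ∀ i j n qn a w, S.localProb i n qn a w = S.localProb j n qn a w

open Classical in
/-- The probability that the user's estimate of the desired message `i` is wrong, when the answer
of database `n` is sent through `length n` independent uses of the channel `W n` and the `N`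
channels are independent. -/
noncomputable def errorProb [∀ n, Fintype (Y n)] (S : Scheme M L X Y)
    (W : ∀ n, Channel (X n) (Y n)) (i : Fin M) : ℝ :=
  ∑ w : Messages M L, ∑ q, S.jointProb i w q *
    ∑ y with S.decode i q y ≠ w i,
      ∏ n, ∏ η, (W n).prob (S.answer n (q n) w η) (y n η)

/-- The total length of all answer strings. -/
def totalLength (S : Scheme M L X Y) : ℕ := ∑ n, S.length n

end Scheme

/-! ### Achievable rates and capacity -/

section Capacity

variable {N : ℕ} {X : Fin N → Type u} {Y : Fin N → Type v} [∀ n, Fintype (Y n)]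

/-- The rate `R` is achievable with traffic ratios `τ`: there are private schemes, one for every
message length `L`, whose error probability tends to zero as `L → ∞`, whose traffic ratios
`t n / ∑ j, t j` tend to `τ n`, and whose rates `L / ∑ n, t n` tend to `R`. -/
def AchievableAt (M : ℕ) (W : ∀ n, Channel (X n) (Y n)) (τ : Fin N → ℝ) (R : ℝ) : Prop :=
  ∃ S : ∀ L : ℕ, Scheme M L X Y,
    (∀ L, (S L).IsPrivate) ∧
    (∀ i, Filter.Tendsto (fun L => (S L).errorProb W i) Filter.atTop (nhds 0)) ∧
    (∀ n, Filter.Tendsto (fun L => ((S L).length n : ℝ) / ((S L).totalLength : ℝ))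
      Filter.atTop (nhds (τ n))) ∧
    Filter.Tendsto (fun L : ℕ => (L : ℝ) / ((S L).totalLength : ℝ)) Filter.atTop (nhds R)

/-- The capacity of noisy private information retrieval: the supremum of all achievable rates over
all vectors of traffic ratios. -/
noncomputable def pirCapacity (M : ℕ) (W : ∀ n, Channel (X n) (Y n)) : ENNReal :=
  ⨆ τ ∈ stdSimplex ℝ (Fin N), ⨆ R ∈ {R : ℝ | AchievableAt M W τ R}, ENNReal.ofReal R

end Capacity

/-! ### Stage counts

Databases are numbered from `0` here, so that group `ℓ` (databases `n_{ℓ-1}+1, …, n_ℓ` in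
one-based numbering) consists of the `j : Fin N` with `n_{ℓ-1} ≤ j < n_ℓ`. -/

section Stages

variable {M : ℕ}

/-- A non-decreasing sequence `n_0 ≤ … ≤ n_{M-1}` in `{1, …, N}`. -/
def IsGroupSeq (N : ℕ) (n : Fin M → ℕ) : Prop :=
  Monotone n ∧ ∀ i, 1 ≤ n i ∧ n i ≤ N

/-- `n_{ℓ-1}`, with `n_{-1} = 0`. -/
def prev (n : Fin M → ℕ) (ℓ : Fin M) : ℕ :=
  if (ℓ : ℕ) = 0 then 0 else n ⟨(ℓ : ℕ) - 1, lt_of_le_of_lt (Nat.sub_le _ _) ℓ.isLt⟩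

/-- The size `n_ℓ - n_{ℓ-1}` of group `ℓ`. -/
def groupSize (n : Fin M → ℕ) (ℓ : Fin M) : ℕ := n ℓ - prev n ℓ

/-- The set `𝒮 = {ℓ : n_ℓ - n_{ℓ-1} > 0}` of the indices of the non-empty groups. -/
def groupIndices (n : Fin M → ℕ) : Finset (Fin M) := {ℓ | prev n ℓ < n ℓ}

/-- The databases of group `ℓ`. -/
def group (N : ℕ) (n : Fin M → ℕ) (ℓ : Fin M) : Finset (Fin N) :=
  {j | prev n ℓ ≤ (j : ℕ) ∧ (j : ℕ) < n ℓ}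

/-- The factor `binom(M-2, s-1)`, where the factor of `s = 0` is `1`. -/
def stageFactor (s : Fin M) : ℕ := if (s : ℕ) = 0 then 1 else (M - 2).choose ((s : ℕ) - 1)

/-- `ξ_ℓ = ∏_{s ∈ 𝒮 \ {ℓ}} binom(M-2, s-1)`. -/
def xi (n : Fin M → ℕ) (ℓ : Fin M) : ℕ := ∏ s ∈ (groupIndices n).erase ℓ, stageFactor s

/-- The number `y_ℓ[k]` of stages (written `stages n k ℓ`), as the solution of the system of
difference equations with its initial conditions; it is only used for `ℓ ∈ 𝒮`, where
`groupSize n ℓ - 1` is not truncated. -/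
def stages [NeZero M] (n : Fin M → ℕ) : ℕ → Fin M → ℕ
  | 0, _ => 0
  | k + 1, ℓ =>
    if k + 1 ≤ (ℓ : ℕ) then 0
    else if k + 1 = 1 then ∏ s ∈ groupIndices n, stageFactor s
    else (if 2 ≤ (ℓ : ℕ) ∧ k + 1 = (ℓ : ℕ) + 1 then n 0 * xi n ℓ else 0)
      + (groupSize n ℓ - 1) * stages n k ℓ
      + ∑ j ∈ (groupIndices n).erase ℓ, groupSize n j * stages n k j

/-- The number `∑_{k=1}^M binom(M, k) y_ℓ[k]` of symbols downloaded in one repetition from each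
database of group `ℓ`. -/
def groupLoad [NeZero M] (n : Fin M → ℕ) (ℓ : Fin M) : ℕ :=
  ∑ k ∈ Finset.Icc 1 M, M.choose k * stages n k ℓ

/-- The number of desired symbols downloaded in one repetition. -/
def desiredSymbols [NeZero M] (n : Fin M → ℕ) : ℕ :=
  ∑ ℓ ∈ groupIndices n, ∑ k ∈ Finset.Icc 1 M,
    (M - 1).choose (k - 1) * stages n k ℓ * groupSize n ℓ

variable {N : ℕ}

/-- The sum over all databases of the number of downloaded symbols divided by the capacity. -/
noncomputable def codedTraffic [NeZero M] (n : Fin M → ℕ) (C : Fin N → ℝ) : ℝ :=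
  ∑ ℓ ∈ groupIndices n, ∑ j ∈ group N n ℓ, (groupLoad n ℓ : ℝ) / C j

/-- The rate `R(n, C)`. -/
noncomputable def rate [NeZero M] (n : Fin M → ℕ) (C : Fin N → ℝ) : ℝ :=
  (desiredSymbols n : ℝ) / codedTraffic n C

/-- The share of database `j` in `codedTraffic`; it is zero if `j` lies in no group. -/
noncomputable def trafficShare [NeZero M] (n : Fin M → ℕ) (C : Fin N → ℝ) (j : Fin N) : ℝ :=
  (∑ ℓ ∈ groupIndices n with j ∈ group N n ℓ, (groupLoad n ℓ : ℝ) / C j) / codedTraffic n C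

/-- All databases that occur in a group have positive capacity, so that no division in
`codedTraffic` is by zero. -/
def UsesPositive (n : Fin M → ℕ) (C : Fin N → ℝ) : Prop :=
  ∀ ℓ ∈ groupIndices n, ∀ j ∈ group N n ℓ, 0 < C j

/-- The maximum of `R(n, C)` over the (finitely many) sequences `n`. -/
noncomputable def maxRate (M : ℕ) [NeZero M] (C : Fin N → ℝ) : ENNReal :=
  ⨆ n ∈ {n : Fin M → ℕ | IsGroupSeq N n ∧ UsesPositive n C}, ENNReal.ofReal (rate n C)

end Stages

end NPIR

/-!
The achieving schemes consist of a combinatorial part, which fixes what is downloaded as if the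
channels were noiseless, and of one channel code per database.

*Downloads.* At database `j`, each stage downloads one sum of `k` symbols for every set `T` of `k`
messages, and each of the `L₀` symbols of a message is a vector of about `L / L₀` bits. If `T`
does not contain the desired message `i`, all summands are fresh. If it does, the summand of message
`i` is fresh and the remaining summands are side information: their sum has been downloaded from
another database, or each of them has been downloaded singly. Hence every symbol of message `i` is
obtained by one subtraction. The difference equations for the stage counts say exactly that the
side information suffices (`isFeasible_dbStages`), and since no database ever sees a position of a
message twice, independent uniform permutations of the positions within the messages make the
queries to a single database independent of `i` (`IsFeasible.exists_pattern`,
`Pattern.scheme_isPrivate`). A message has as many positions in this construction as there are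
downloads that involve it; this number is the same for all messages and equals `desiredSymbols`.

*Codes.* Feinstein's lemma and Chernoff's bound give block codes of every rate below capacity with
small maximal error probability (`Channel.eventually_hasCode`). The maximal error matters, because
the downloads from a database need not be uniformly distributed once messages have been padded.
Letting the rate tend to the capacity slowly, database `j` needs asymptotically `1 / C j` channel
uses per downloaded bit (`Channel.exists_code_sequence`), and a union bound over the databases
controls the total error (`Pattern.scheme_errorProb_le`).
-/

namespace NPIR

/-! ### The coding theorem for discrete memoryless channels -/

namespace Channel

variable {X : Type u} {Y : Type v} [Fintype Y]

/-- The distribution of the channel output under the input distribution `p`. -/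
noncomputable def outputProb [Fintype X] (W : Channel X Y) (p : X → ℝ) (y : Y) : ℝ :=
  ∑ x, p x * W.prob x y

/-- The channel obtained by `t` independent uses of `W`. -/
def block (W : Channel X Y) (t : ℕ) : Channel (Fin t → X) (Fin t → Y) where
  prob x y := ∏ η, W.prob (x η) (y η)
  prob_nonneg x y := Finset.prod_nonneg fun η _ => W.prob_nonneg _ _
  prob_sum x := by
    have h := Finset.prod_univ_sum (fun _ : Fin t => (Finset.univ : Finset Y))
      (fun η y => W.prob (x η) y)
    simp only [W.prob_sum, Finset.prod_const_one, Fintype.piFinset_univ] at h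
    exact h.symm

lemma sum_prob_le_one (W : Channel X Y) (x : X) (s : Finset Y) : ∑ y ∈ s, W.prob x y ≤ 1 := by
  rw [← W.prob_sum x]
  exact Finset.sum_le_sum_of_subset_of_nonneg (Finset.subset_univ _)
    fun y _ _ => W.prob_nonneg x y

open Classical in
/-- Feinstein's maximal code lemma. Codewords are chosen one after the other; as long as the
decoding sets chosen so far have small probability at the output, averaging over the input
distribution yields a further codeword. -/
lemma exists_disjoint_decoding_sets [Fintype X] (W : Channel X Y) {p : X → ℝ}
    (hp : p ∈ stdSimplex ℝ X) (G : X → Finset Y) {lam δ : ℝ} (hlam : 0 < lam)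
    (hG : ∀ x, ∀ y ∈ G x, W.outputProb p y ≤ lam * W.prob x y) (K : ℕ)
    (hK : 1 - δ + K * lam ≤ ∑ x, p x * ∑ y ∈ G x, W.prob x y) :
    ∃ (enc : Fin K → X) (B : Fin K → Finset Y), (∀ a b, a ≠ b → Disjoint (B a) (B b)) ∧
      (∀ a, B a ⊆ G (enc a)) ∧ ∀ a, 1 - δ ≤ ∑ y ∈ B a, W.prob (enc a) y := by
  induction K with
  | zero => exact ⟨Fin.elim0, Fin.elim0, fun a => a.elim0, fun a => a.elim0, fun a => a.elim0⟩
  | succ K ih =>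
    push_cast at hK
    obtain ⟨enc, B, hdisj, hsub, hB⟩ := ih (by linarith)
    set U : Finset Y := Finset.univ.biUnion B with hU
    have hUprob : ∑ y ∈ U, W.outputProb p y ≤ K * lam := by
      rw [hU, Finset.sum_biUnion (fun a _ b _ hab => hdisj a b hab)]
      calc ∑ a, ∑ y ∈ B a, W.outputProb p y ≤ ∑ _a : Fin K, lam := by
            refine Finset.sum_le_sum fun a _ => ?_
            calc ∑ y ∈ B a, W.outputProb p y ≤ ∑ y ∈ B a, lam * W.prob (enc a) y :=
                  Finset.sum_le_sum fun y hy => hG _ _ (hsub a hy)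
              _ = lam * ∑ y ∈ B a, W.prob (enc a) y := by rw [Finset.mul_sum]
              _ ≤ lam * 1 := by gcongr; exact W.sum_prob_le_one _ _
              _ = lam := mul_one _
        _ = K * lam := by simp
    obtain ⟨x, hx⟩ : ∃ x, 1 - δ ≤ ∑ y ∈ G x \ U, W.prob x y := by
      by_contra! hcon
      have h1 : ∑ x, p x * ∑ y ∈ G x, W.prob x y ≤ (1 - δ) + K * lam := by
        calc ∑ x, p x * ∑ y ∈ G x, W.prob x y
            ≤ ∑ x, (p x * (1 - δ) + p x * ∑ y ∈ U, W.prob x y) := by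
              refine Finset.sum_le_sum fun x _ => ?_
              rw [← mul_add]
              refine mul_le_mul_of_nonneg_left ?_ (hp.1 x)
              have h2 : ∑ y ∈ G x, W.prob x y
                  ≤ ∑ y ∈ G x \ U, W.prob x y + ∑ y ∈ U, W.prob x y := by
                rw [← Finset.sum_union Finset.sdiff_disjoint]
                refine Finset.sum_le_sum_of_subset_of_nonneg ?_ fun y _ _ => W.prob_nonneg x y
                intro y hy
                by_cases h : y ∈ U <;> simp [hy, h]
              linarith [hcon x]
          _ = (1 - δ) + ∑ y ∈ U, W.outputProb p y := by
              rw [Finset.sum_add_distrib, ← Finset.sum_mul, hp.2, one_mul]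
              congr 1
              simp only [outputProb, Finset.mul_sum]
              exact Finset.sum_comm
          _ ≤ _ := by linarith
      linarith
    refine ⟨Fin.snoc enc x, Fin.snoc B (G x \ U), ?_, ?_, ?_⟩
    · have hlast : ∀ a : Fin K, Disjoint (B a) (G x \ U) := fun a =>
        Finset.disjoint_sdiff.mono_left (Finset.subset_biUnion_of_mem B (Finset.mem_univ a))
      intro a b
      induction a using Fin.lastCases with
      | last =>
        induction b using Fin.lastCases with
        | last => simp
        | cast b => simpa using fun _ => (hlast b).symm
      | cast a =>
        induction b using Fin.lastCases with
        | last => simpa using hlast a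
        | cast b => simpa using hdisj a b
    · intro a
      induction a using Fin.lastCases with
      | last => simp
      | cast a => simpa using hsub a
    · intro a
      induction a using Fin.lastCases with
      | last => simpa using hx
      | cast a => simpa using hB a

open Classical in
/-- A code for the messages in `A` with error probability at most `ε` for every message. -/
def HasCode (W : Channel X Y) (A : Type) (ε : ℝ) : Prop :=
  ∃ (enc : A → X) (dec : Y → A), ∀ a, ∑ y with dec y ≠ a, W.prob (enc a) y ≤ ε

/-- Feinstein's lemma with a decoder that uses the disjoint decoding sets. -/
lemma hasCode_of_sum_le [Fintype X] (W : Channel X Y) {p : X → ℝ}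
    (hp : p ∈ stdSimplex ℝ X) (G : X → Finset Y) {lam δ : ℝ} (hlam : 0 < lam)
    (hG : ∀ x, ∀ y ∈ G x, W.outputProb p y ≤ lam * W.prob x y)
    (A : Type) [Fintype A] [Nonempty A]
    (hA : 1 - δ + Fintype.card A * lam ≤ ∑ x, p x * ∑ y ∈ G x, W.prob x y) :
    W.HasCode A δ := by
  classical
  obtain ⟨enc, B, hdisj, -, hB⟩ := W.exists_disjoint_decoding_sets hp G hlam hG _ hA
  let e := Fintype.equivFin A
  let dec : Y → A := fun y =>
    if h : ∃ a, y ∈ B a then e.symm h.choose else Classical.arbitrary A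
  have hdec : ∀ a, ∀ y ∈ B (e a), dec y = a := by
    intro a y hy
    have h : ∃ a, y ∈ B a := ⟨_, hy⟩
    have h' : h.choose = e a := by
      by_contra hne
      exact Finset.disjoint_left.mp (hdisj _ _ hne) h.choose_spec hy
    simp [dec, dif_pos h, h']
  refine ⟨fun a => enc (e a), dec, fun a => ?_⟩
  have h1 : ∑ y with dec y ≠ a, W.prob (enc (e a)) y + ∑ y ∈ B (e a), W.prob (enc (e a)) y
      ≤ 1 := by
    rw [← Finset.sum_union]
    · exact W.sum_prob_le_one _ _
    · rw [Finset.disjoint_left]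
      intro y hy hy'
      exact (Finset.mem_filter.mp hy).2 (hdec a y hy')
  linarith [hB (e a)]

end Channel

/-- A function of positive mean has an exponential moment with negative exponent below one, since
the derivative of this moment at exponent zero is minus the mean. -/
lemma exists_sum_mul_exp_lt_one {Z : Type*} [Fintype Z] {P : Z → ℝ} (hP : P ∈ stdSimplex ℝ Z)
    {f : Z → ℝ} (hf : 0 < ∑ z, P z * f z) : ∃ s > 0, ∑ z, P z * Real.exp (-(s * f z)) < 1 := by
  have hd : HasDerivAt (fun s : ℝ => ∑ z, P z * Real.exp (-(s * f z))) (-∑ z, P z * f z) 0 := by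
    have : ∀ z ∈ (Finset.univ : Finset Z),
        HasDerivAt (fun s : ℝ => P z * Real.exp (-(s * f z))) (-(P z * f z)) 0 := by
      intro z _
      have h := (((hasDerivAt_id (0 : ℝ)).mul_const (f z)).neg.exp).const_mul (P z)
      simpa using h
    simpa using HasDerivAt.fun_sum this
  have h0 := hd.tendsto_slope_zero_right
  have hev := h0.eventually_lt_const (show -∑ z, P z * f z < 0 by linarith)
  obtain ⟨s, hs, hs0⟩ := (hev.and self_mem_nhdsWithin).exists
  refine ⟨s, hs0, ?_⟩
  have hs0' : (0 : ℝ) < s := hs0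
  simp only [zero_add, zero_mul, neg_zero, Real.exp_zero, mul_one, hP.2, smul_eq_mul] at hs
  have := neg_of_mul_neg_right hs (inv_pos.mpr hs0').le
  linarith

open Classical in
/-- Chernoff's bound for the probability that a sum of independent terms is negative. -/
lemma sum_prod_le_pow {Z : Type*} [Fintype Z] {P : Z → ℝ} (hP : ∀ z, 0 ≤ P z)
    (f : Z → ℝ) {s : ℝ} (hs : 0 < s) (t : ℕ) :
    ∑ z : Fin t → Z with ∑ η, f (z η) < 0, ∏ η, P (z η)
      ≤ (∑ z, P z * Real.exp (-(s * f z))) ^ t := by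
  rw [Fintype.sum_pow]
  calc ∑ z : Fin t → Z with ∑ η, f (z η) < 0, ∏ η, P (z η)
      ≤ ∑ z : Fin t → Z with ∑ η, f (z η) < 0, ∏ η, P (z η) * Real.exp (-(s * f (z η))) := by
        refine Finset.sum_le_sum fun z hz => ?_
        rw [Finset.prod_mul_distrib, ← Real.exp_sum]
        refine le_mul_of_one_le_right (Finset.prod_nonneg fun η _ => hP _) ?_
        rw [Finset.sum_neg_distrib, ← Finset.mul_sum]
        refine Real.one_le_exp ?_
        have := (Finset.mem_filter.mp hz).2
        nlinarith
    _ ≤ _ := Finset.sum_le_sum_of_subset_of_nonneg (Finset.subset_univ _) fun z _ _ =>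
        Finset.prod_nonneg fun η _ => mul_nonneg (hP _) (Real.exp_pos _).le

namespace Channel

variable {X : Type u} {Y : Type v} [Fintype X] [Fintype Y]

lemma outputProb_block (W : Channel X Y) (p : X → ℝ) (t : ℕ) (y : Fin t → Y) :
    (W.block t).outputProb (fun x => ∏ η, p (x η)) y = ∏ η, W.outputProb p (y η) := by
  classical
  simp only [outputProb, block, ← Finset.prod_mul_distrib]
  rw [Finset.prod_univ_sum, Fintype.piFinset_univ]

lemma prod_mem_stdSimplex {p : X → ℝ} (hp : p ∈ stdSimplex ℝ X) (t : ℕ) :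
    (fun x : Fin t → X => ∏ η, p (x η)) ∈ stdSimplex ℝ (Fin t → X) := by
  classical
  refine ⟨fun x => Finset.prod_nonneg fun η _ => hp.1 _, ?_⟩
  rw [← Fintype.sum_pow, hp.2, one_pow]

lemma joint_mem_stdSimplex (W : Channel X Y) {p : X → ℝ} (hp : p ∈ stdSimplex ℝ X) :
    (fun z : X × Y => p z.1 * W.prob z.1 z.2) ∈ stdSimplex ℝ (X × Y) := by
  refine ⟨fun z => mul_nonneg (hp.1 _) (W.prob_nonneg _ _), ?_⟩
  simp [Fintype.sum_prod_type, ← Finset.mul_sum, W.prob_sum, hp.2]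

/-- If no letter pair has probability zero and the information densities exceed `R` on average,
then the likelihood ratio is at least `2 ^ (R t)`. -/
lemma prod_le_rpow_mul_prod {t : ℕ} {R : ℝ} {a b : Fin t → ℝ} (ha : ∀ η, 0 < a η)
    (hb : ∀ η, 0 < b η) (h : 0 ≤ ∑ η, (Real.logb 2 (a η / b η) - R)) :
    ∏ η, b η ≤ (2 : ℝ) ^ (-(R * t)) * ∏ η, a η := by
  have h2 : ∏ η, (a η / b η) = (2 : ℝ) ^ (∑ η, Real.logb 2 (a η / b η)) := by
    rw [Real.rpow_sum_of_pos two_pos]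
    refine Finset.prod_congr rfl fun η _ => ?_
    rw [Real.rpow_logb two_pos (by norm_num) (div_pos (ha η) (hb η))]
  have h3 : (2 : ℝ) ^ (R * t) ≤ ∏ η, (a η / b η) := by
    rw [h2]
    refine Real.rpow_le_rpow_of_exponent_le one_le_two ?_
    simp only [Finset.sum_sub_distrib, Finset.sum_const, Finset.card_univ, Fintype.card_fin,
      nsmul_eq_mul] at h
    linarith
  rw [Finset.prod_div_distrib, le_div_iff₀ (Finset.prod_pos fun η _ => hb η)] at h3
  rw [Real.rpow_neg two_pos.le, ← div_eq_inv_mul, le_div_iff₀ (by positivity)]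
  linarith

open Filter in
/-- The achievability half of the channel coding theorem, with maximal error probability. -/
theorem eventually_hasCode (W : Channel X Y) {R : ℝ} (hR : R < W.capacity)
    (hC : 0 < W.capacity) {δ : ℝ} (hδ : 0 < δ) :
    ∀ᶠ t : ℕ in atTop, ∀ (A : Type) [Fintype A] [Nonempty A],
      (Fintype.card A : ℝ) ≤ (2 : ℝ) ^ (R * t) → (W.block t).HasCode A δ := by
  classical
  have hne : (W.mutualInfo '' stdSimplex ℝ X).Nonempty := by
    by_contra h
    rw [Set.not_nonempty_iff_eq_empty] at h
    simp [capacity, h] at hC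
  obtain ⟨_, ⟨p, hp, rfl⟩, hI⟩ := exists_lt_of_lt_csSup hne hR
  obtain ⟨R', hRR', hR'⟩ := exists_between hI
  let f : X × Y → ℝ := fun z => Real.logb 2 (W.prob z.1 z.2 / W.outputProb p z.2) - R'
  have hP := W.joint_mem_stdSimplex hp
  have hf : 0 < ∑ z : X × Y, (p z.1 * W.prob z.1 z.2) * f z := by
    simp only [f, mul_sub, Finset.sum_sub_distrib, ← Finset.sum_mul, hP.2]
    rw [Fintype.sum_prod_type]
    have : W.mutualInfo p = ∑ x, ∑ y, p x * W.prob x y *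
      Real.logb 2 (W.prob x y / W.outputProb p y) := rfl
    simp only [← this]
    linarith
  obtain ⟨s, hs, hlt⟩ := exists_sum_mul_exp_lt_one hP hf
  set c := ∑ z : X × Y, (p z.1 * W.prob z.1 z.2) * Real.exp (-(s * f z)) with hc
  have hc0 : 0 ≤ c := Finset.sum_nonneg fun z _ => mul_nonneg (hP.1 z) (Real.exp_pos _).le
  have hlim : Tendsto (fun t : ℕ => c ^ t + ((2 : ℝ) ^ (R - R')) ^ t) atTop (nhds 0) := by
    have h1 := tendsto_pow_atTop_nhds_zero_of_lt_one hc0 hlt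
    have h2 : Tendsto (fun t : ℕ => ((2 : ℝ) ^ (R - R')) ^ t) atTop (nhds 0) :=
      tendsto_pow_atTop_nhds_zero_of_lt_one (by positivity)
        (Real.rpow_lt_one_of_one_lt_of_neg one_lt_two (by linarith))
    simpa using h1.add h2
  filter_upwards [hlim.eventually_le_const hδ] with t ht A _ _ hA
  -- the pairs of words with likelihood ratio at least `2 ^ (R' t)`, where `R < R' < I(p)`
  let G : (Fin t → X) → Finset (Fin t → Y) := fun x =>
    {y | (W.block t).outputProb (fun x => ∏ η, p (x η)) y
      ≤ (2 : ℝ) ^ (-(R' * t)) * (W.block t).prob x y}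
  refine (W.block t).hasCode_of_sum_le (prod_mem_stdSimplex hp t) G
    (lam := (2 : ℝ) ^ (-(R' * t))) (by positivity) (fun x y hy => (Finset.mem_filter.mp hy).2)
    A ?_
  have hcard : Fintype.card A * (2 : ℝ) ^ (-(R' * t)) ≤ ((2 : ℝ) ^ (R - R')) ^ t := by
    calc Fintype.card A * (2 : ℝ) ^ (-(R' * t))
        ≤ (2 : ℝ) ^ (R * t) * (2 : ℝ) ^ (-(R' * t)) := by gcongr
      _ = ((2 : ℝ) ^ (R - R')) ^ t := by
        rw [← Real.rpow_add two_pos, ← Real.rpow_mul_natCast two_pos.le]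
        congr 1; ring
  -- a pair of words outside `G` is atypical or has probability zero
  have hbad : ∑ x : Fin t → X, ∑ y ∈ (G x)ᶜ, (∏ η, p (x η)) * (W.block t).prob x y ≤ c ^ t := by
    refine le_trans ?_ (sum_prod_le_pow hP.1 f hs t)
    have e1 : ∑ x : Fin t → X, ∑ y ∈ (G x)ᶜ, (∏ η, p (x η)) * (W.block t).prob x y
        = ∑ x : Fin t → X, ∑ y : Fin t → Y,
          if y ∈ (G x)ᶜ then (∏ η, p (x η)) * (W.block t).prob x y else 0 := by
      refine Finset.sum_congr rfl fun x _ => ?_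
      rw [Finset.sum_ite_mem, Finset.univ_inter]
    rw [e1, ← Fintype.sum_prod_type', Finset.sum_filter,
      ← (Equiv.arrowProdEquivProdArrow (Fin t) (fun _ => X) (fun _ => Y)).sum_comp]
    refine Finset.sum_le_sum fun z _ => ?_
    change (if (fun η => (z η).2) ∈ (G fun η => (z η).1)ᶜ then (∏ η, p (z η).1) *
      (W.block t).prob (fun η => (z η).1) (fun η => (z η).2) else 0) ≤ _
    have hnn : 0 ≤ ∏ η, (p (z η).1 * W.prob (z η).1 (z η).2) :=
      Finset.prod_nonneg fun η _ => hP.1 (z η)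
    have heq : (∏ η, p (z η).1) * (W.block t).prob (fun η => (z η).1) (fun η => (z η).2)
        = ∏ η, (p (z η).1 * W.prob (z η).1 (z η).2) := by
      rw [Finset.prod_mul_distrib]; rfl
    rw [heq]
    by_cases hG : (fun η => (z η).2) ∈ G (fun η => (z η).1)
    · rw [if_neg (by simpa using hG)]; split_ifs <;> [exact hnn; exact le_rfl]
    rw [if_pos (by simpa using hG)]
    by_cases hneg : ∑ η, f (z η) < 0
    · rw [if_pos hneg]
    rw [if_neg hneg]
    refine le_of_not_gt fun hpos => hG ?_
    have hz : ∀ η, 0 < p (z η).1 * W.prob (z η).1 (z η).2 := by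
      intro η
      refine lt_of_le_of_ne (hP.1 (z η)) fun h0 => hpos.ne' ?_
      exact Finset.prod_eq_zero (Finset.mem_univ η) h0.symm
    have ha : ∀ η, 0 < W.prob (z η).1 (z η).2 := fun η =>
      pos_of_mul_pos_right (hz η) (hp.1 _)
    have hb : ∀ η, 0 < W.outputProb p (z η).2 := fun η =>
      lt_of_lt_of_le (hz η) (Finset.single_le_sum
        (f := fun x => p x * W.prob x (z η).2)
        (fun x _ => mul_nonneg (hp.1 _) (W.prob_nonneg _ _)) (Finset.mem_univ (z η).1))
    refine Finset.mem_filter.mpr ⟨Finset.mem_univ _, ?_⟩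
    rw [outputProb_block]
    exact prod_le_rpow_mul_prod ha hb (not_lt.mp hneg)
  have htot : ∑ x : Fin t → X, (∏ η, p (x η)) * ∑ y ∈ G x, (W.block t).prob x y
      + ∑ x : Fin t → X, ∑ y ∈ (G x)ᶜ, (∏ η, p (x η)) * (W.block t).prob x y = 1 := by
    rw [← Finset.sum_add_distrib, ← (prod_mem_stdSimplex hp t).2]
    refine Finset.sum_congr rfl fun x _ => ?_
    rw [← Finset.mul_sum, ← mul_add, Finset.sum_add_sum_compl, (W.block t).prob_sum, mul_one]
  linarith

open Filter in
/-- Codes for `2 ^ (D r)` messages whose block length grows like `r D / C` and whose maximal error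
probability tends to zero. For each margin `1 / (m + 1)` over the block length `r D / C` the coding
theorem gives a good code for all large `r`, and the margin is diminished slowly with `r`.
For `D = 0` the block length is zero, whatever the capacity. -/
theorem exists_code_sequence (W : Channel X Y) (D : ℕ) (h : 0 < W.capacity ∨ D = 0) :
    ∃ (t : ℕ → ℕ) (ε : ℕ → ℝ),
      Tendsto (fun r => (t r : ℝ) / r) atTop (nhds (D / W.capacity)) ∧
      Tendsto ε atTop (nhds 0) ∧ ∀ (r : ℕ) (A : Type) [Fintype A] [Nonempty A],
        Fintype.card A ≤ 2 ^ (D * r) → (W.block (t r)).HasCode A (ε r) := by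
  classical
  have htriv : ∀ (A : Type) [Nonempty A], (W.block 0).HasCode A 1 := fun A _ =>
    ⟨fun _ => Fin.elim0, fun _ => Classical.arbitrary A, fun a => sum_prob_le_one _ _ _⟩
  rcases Nat.eq_zero_or_pos D with rfl | hD
  · refine ⟨fun _ => 0, fun _ => 0, by simp, by simp, fun r A _ _ hA => ?_⟩
    have hA' : ∀ a b : A, a = b := Fintype.card_le_one_iff.mp (by simpa using hA)
    refine ⟨fun _ => Fin.elim0, fun _ => Classical.arbitrary A, fun a => ?_⟩
    refine (Finset.sum_eq_zero fun y hy => ?_).le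
    exact absurd (hA' _ _) (Finset.mem_filter.mp hy).2
  have hC : 0 < W.capacity := h.resolve_right hD.ne'
  let len : ℕ → ℕ → ℕ := fun m r => ⌈((D : ℝ) / W.capacity + 1 / ((m : ℝ) + 1)) * r⌉₊
  let Good : ℕ → ℕ → Prop := fun m r => ∀ (A : Type) [Fintype A] [Nonempty A],
    Fintype.card A ≤ 2 ^ (D * r) → (W.block (len m r)).HasCode A (1 / ((m : ℝ) + 1))
  have hgood : ∀ m, ∀ᶠ r in atTop, Good m r := by
    intro m
    have hm : (0 : ℝ) < 1 / ((m : ℝ) + 1) := by positivity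
    set c := (D : ℝ) / W.capacity + 1 / ((m : ℝ) + 1) with hc
    have hDC : 0 < (D : ℝ) / W.capacity := by positivity
    have hc0 : 0 < c := by positivity
    -- block length `c r` for `D r` bits is rate `D / c`, which is below capacity
    have hR : (D : ℝ) / c < W.capacity := by
      rw [div_lt_iff₀ hc0, hc, mul_add, mul_div_cancel₀ _ hC.ne']
      nlinarith
    have hlen : Tendsto (len m) atTop atTop :=
      tendsto_nat_ceil_atTop.comp
        (tendsto_natCast_atTop_atTop.const_mul_atTop hc0)
    filter_upwards [hlen.eventually (W.eventually_hasCode hR hC hm)] with r hr A _ _ hA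
    refine hr A ?_
    calc (Fintype.card A : ℝ) ≤ ((2 ^ (D * r) : ℕ) : ℝ) := by exact_mod_cast hA
      _ = (2 : ℝ) ^ ((D * r : ℕ) : ℝ) := by rw [Real.rpow_natCast]; push_cast; rfl
      _ ≤ (2 : ℝ) ^ ((D : ℝ) / c * len m r) := by
        refine Real.rpow_le_rpow_of_exponent_le one_le_two ?_
        have h1 : c * r ≤ len m r := Nat.le_ceil _
        calc ((D * r : ℕ) : ℝ) = (D : ℝ) / c * (c * r) := by
              rw [← mul_assoc, div_mul_cancel₀ _ hc0.ne']; push_cast; rfl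
          _ ≤ _ := by gcongr
  -- the smallest margin with index at most `r` that admits a good code; for the finitely many `r`
  -- without any, block length zero and the error bound one are used
  let m : ℕ → ℕ := fun r => Nat.findGreatest (fun m => Good m r) r
  have hm : Tendsto m atTop atTop := by
    refine tendsto_atTop.mpr fun b => ?_
    filter_upwards [hgood b, eventually_ge_atTop b] with r hr hbr
    exact Nat.le_findGreatest hbr hr
  have hgm : ∀ᶠ r in atTop, Good (m r) r := by
    filter_upwards [hgood 0] with r hr
    exact Nat.findGreatest_spec (P := fun m => Good m r) (Nat.zero_le r) hr
  have hinv : Tendsto (fun r => 1 / ((m r : ℝ) + 1)) atTop (nhds 0) :=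
    tendsto_one_div_add_atTop_nhds_zero_nat.comp hm
  refine ⟨fun r => if Good (m r) r then len (m r) r else 0,
    fun r => if Good (m r) r then 1 / ((m r : ℝ) + 1) else 1, ?_, ?_, fun r A _ _ hA => ?_⟩
  · have hlow : Tendsto (fun r => (D : ℝ) / W.capacity + 1 / ((m r : ℝ) + 1)) atTop
        (nhds (D / W.capacity)) := by simpa using hinv.const_add ((D : ℝ) / W.capacity)
    have hupp : Tendsto (fun r : ℕ => (D : ℝ) / W.capacity + 1 / ((m r : ℝ) + 1) + 1 / (r : ℝ))
        atTop (nhds (D / W.capacity)) := by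
      simpa using hlow.add tendsto_one_div_atTop_nhds_zero_nat
    refine tendsto_of_tendsto_of_tendsto_of_le_of_le' hlow hupp ?_ ?_
    · filter_upwards [hgm, eventually_gt_atTop 0] with r hr hr0
      have hr0' : (0 : ℝ) < r := by exact_mod_cast hr0
      rw [if_pos hr, le_div_iff₀ hr0']
      exact Nat.le_ceil _
    · filter_upwards [hgm, eventually_gt_atTop 0] with r hr hr0
      have hr0' : (0 : ℝ) < r := by exact_mod_cast hr0
      rw [if_pos hr, div_le_iff₀ hr0', add_mul, one_div_mul_cancel hr0'.ne']
      exact (Nat.ceil_lt_add_one (by positivity)).le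
  · refine hinv.congr' ?_
    filter_upwards [hgm] with r hr
    rw [if_pos hr]
  · have key : ∀ (k : ℕ) (e : ℝ), (Good (m r) r → k = len (m r) r ∧ e = 1 / ((m r : ℝ) + 1)) →
        (¬ Good (m r) r → k = 0 ∧ e = 1) → (W.block k).HasCode A e := by
      intro k e h1 h2
      by_cases hr : Good (m r) r
      · obtain ⟨rfl, rfl⟩ := h1 hr
        exact hr A hA
      · obtain ⟨rfl, rfl⟩ := h2 hr
        exact htriv A
    exact key _ _ (fun hr => ⟨if_pos hr, if_pos hr⟩) fun hr => ⟨if_neg hr, if_neg hr⟩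

end Channel

/-! ### Retrieval schemes from retrieval patterns -/

/-- A retrieval pattern for `M` messages of `L₀` symbols each and `N` databases: the combinatorial
skeleton of one repetition of a noiseless scheme. Each download from database `j` is the sum of at
most one symbol of every message. -/
structure Pattern (M N L₀ : ℕ) where
  /-- the symbols downloaded from a database -/
  Item : Fin N → Type
  [fintypeItem : ∀ j, Fintype (Item j)]
  /-- `place i j m x` is the position in message `m` of the summand of the download `x` from
  database `j` which comes from message `m`, when message `i` is desired; it is `none` if there is
  no such summand. -/
  place : Fin M → ∀ j, Fin M → Item j → Option (Fin L₀)
  /-- After a random permutation of the positions, a database cannot tell the patterns apart. -/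
  exists_perm : ∀ i i' j m, ∃ σ : Equiv.Perm (Fin L₀), ∀ x,
    place i' j m x = (place i j m x).map σ
  /-- The downloads determine the desired message. -/
  decodable : ∀ i {V : Type} [AddCommGroup V] (u : Fin M → Fin L₀ → V),
    (∀ j x, ∑ m, (place i j m x).elim 0 (u m) = 0) → u i = 0

attribute [instance] Pattern.fintypeItem

namespace Pattern

variable {M N L₀ : ℕ} (P : Pattern M N L₀)

/-- A query to database `j` names the positions of the symbols to be added. -/
abbrev Query (j : Fin N) : Type := Fin M → P.Item j → Option (Fin L₀)

/-- The queries when the positions within message `m` are permuted by `π m`. -/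
def query (i : Fin M) (π : Fin M → Equiv.Perm (Fin L₀)) (j : Fin N) : P.Query j :=
  fun m x => (P.place i j m x).map (π m)

/-- The symbols which database `j` sends, when the messages are `u`. -/
def symbols {V : Type} [AddCommGroup V] {j : Fin N} (q : P.Query j) (u : Fin M → Fin L₀ → V)
    (x : P.Item j) : V :=
  ∑ m, (q m x).elim 0 (u m)

/-- By linearity, decodability means that equal downloads come from equal desired messages. -/
lemma eq_of_symbols_eq {V : Type} [AddCommGroup V] {i : Fin M} {π : Fin M → Equiv.Perm (Fin L₀)}
    {u u' : Fin M → Fin L₀ → V}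
    (h : ∀ j, P.symbols (P.query i π j) u = P.symbols (P.query i π j) u') : u i = u' i := by
  have h0 := P.decodable i (fun m p => u m (π m p) - u' m (π m p)) fun j x => by
    have hx := congrFun (h j) x
    rw [symbols, symbols, ← sub_eq_zero, ← Finset.sum_sub_distrib] at hx
    refine (Finset.sum_congr rfl fun m _ => ?_).trans hx
    cases hm : P.place i j m x <;> simp [query, hm]
  funext p
  have := congrFun h0 ((π i).symm p)
  simpa [sub_eq_zero] using this

open Classical in
/-- The distribution of the queries, for independent uniform permutations of the positions. -/
noncomputable def queryProb (i : Fin M) (q : ∀ j, P.Query j) : ℝ :=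
  (Fintype.card (Fin M → Equiv.Perm (Fin L₀)) : ℝ)⁻¹ *
    ∑ π : Fin M → Equiv.Perm (Fin L₀), if P.query i π = q then 1 else 0

open Classical in
lemma sum_queryProb_mul (i : Fin M) (F : (∀ j, P.Query j) → ℝ) :
    ∑ q, P.queryProb i q * F q = (Fintype.card (Fin M → Equiv.Perm (Fin L₀)) : ℝ)⁻¹ *
      ∑ π : Fin M → Equiv.Perm (Fin L₀), F (P.query i π) := by
  simp only [queryProb, mul_assoc, ← Finset.mul_sum, Finset.sum_mul]
  rw [Finset.sum_comm]
  simp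

/-- The number of bits per symbol in the transmission of `L` bits as `L₀` symbols. -/
def bitsPerSymbol (L L₀ : ℕ) : ℕ := L / L₀ + 1

/-- A message of `L` bits as a sequence of `L₀` symbols, padded with zeros. -/
def pad {L : ℕ} (L₀ : ℕ) (a : Fin L → ZMod 2) (p : Fin L₀) (b : Fin (bitsPerSymbol L L₀)) :
    ZMod 2 :=
  if h : (p : ℕ) * bitsPerSymbol L L₀ + b < L then a ⟨p * bitsPerSymbol L L₀ + b, h⟩ else 0

lemma pad_injective {L L₀ : ℕ} (h : 0 < L₀) :
    Function.Injective (pad L₀ : (Fin L → ZMod 2) → _) := by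
  intro a a' haa
  funext l
  have hr : 0 < bitsPerSymbol L L₀ := Nat.succ_pos _
  have hlt : (l : ℕ) / bitsPerSymbol L L₀ < L₀ := by
    refine Nat.div_lt_of_lt_mul (l.isLt.trans ?_)
    rw [mul_comm]
    exact Nat.lt_mul_div_succ L h
  have := congrFun (congrFun haa ⟨_, hlt⟩) ⟨_, Nat.mod_lt l hr⟩
  simpa [pad, Nat.div_add_mod'] using this

variable {X : Fin N → Type u} {Y : Fin N → Type v} {L : ℕ} {t : Fin N → ℕ}

open Classical in
/-- The scheme in which every database encodes its symbols for its channel. The user decodes the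
symbols and looks for messages which are consistent with them. -/
noncomputable def scheme (L : ℕ) (t : Fin N → ℕ)
    (enc : ∀ j, (P.Item j → Fin (bitsPerSymbol L L₀) → ZMod 2) → Fin (t j) → X j)
    (dec : ∀ j, (Fin (t j) → Y j) → P.Item j → Fin (bitsPerSymbol L L₀) → ZMod 2) :
    Scheme M L X Y where
  Query := P.Query
  queryProb := P.queryProb
  queryProb_nonneg i q := mul_nonneg (by positivity)
    (Finset.sum_nonneg fun π _ => by split_ifs <;> norm_num)
  queryProb_sum i := by
    have h := P.sum_queryProb_mul i fun _ => 1
    simp only [mul_one] at h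
    rw [h, Finset.sum_const, Finset.card_univ, nsmul_eq_mul, mul_one,
      inv_mul_cancel₀ (by exact_mod_cast Fintype.card_ne_zero)]
  length := t
  answer j q w := enc j (P.symbols q fun m => pad L₀ (w m))
  decode i q y :=
    if h : ∃ w : Messages M L, ∀ j, P.symbols (q j) (fun m => pad L₀ (w m)) = dec j (y j)
    then h.choose i else 0

/-- Replacing the desired message composes the uniform permutations with fixed ones, as far as one
database is concerned, and this preserves their distribution. -/
lemma scheme_isPrivate
    (enc : ∀ j, (P.Item j → Fin (bitsPerSymbol L L₀) → ZMod 2) → Fin (t j) → X j)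
    (dec : ∀ j, (Fin (t j) → Y j) → P.Item j → Fin (bitsPerSymbol L L₀) → ZMod 2) :
    (P.scheme L t enc dec).IsPrivate := by
  classical
  intro i i' j qj a w
  have key : ∀ i, (P.scheme L t enc dec).localProb i j qj a w =
      (Fintype.card (Messages M L) : ℝ)⁻¹ *
        ((Fintype.card (Fin M → Equiv.Perm (Fin L₀)) : ℝ)⁻¹ *
          ∑ π : Fin M → Equiv.Perm (Fin L₀), if P.query i π j = qj ∧
            enc j (P.symbols (P.query i π j) fun m => pad L₀ (w m)) = a then 1 else 0) := by
    intro i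
    rw [← P.sum_queryProb_mul i (fun q => if q j = qj ∧
      enc j (P.symbols (q j) fun m => pad L₀ (w m)) = a then 1 else 0), Finset.mul_sum,
      Scheme.localProb, Finset.sum_filter]
    refine Finset.sum_congr (by congr!) fun q _ => ?_
    simp only [mul_ite, mul_one, mul_zero]
    congr!
  rw [key, key]
  congr 2
  choose σ hσ using P.exists_perm i i' j
  rw [← Equiv.sum_comp (Equiv.mulRight σ)]
  refine Finset.sum_congr rfl fun π _ => ?_
  have hq : P.query i' π j = P.query i (π * σ) j := by
    funext m x
    simp [query, hσ, Option.map_map, Equiv.Perm.coe_mul]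
  rw [hq]
  rfl

lemma sum_biUnion_le {ι α : Type*} [DecidableEq α] (I : Finset ι) (s : ι → Finset α) (f : α → ℝ)
    (hf : ∀ a, 0 ≤ f a) : ∑ a ∈ I.biUnion s, f a ≤ ∑ i ∈ I, ∑ a ∈ s i, f a := by
  classical
  induction I using Finset.induction_on with
  | empty => simp
  | insert i I hi ih =>
    rw [Finset.biUnion_insert, Finset.sum_insert hi]
    have h1 := Finset.sum_union_inter (s₁ := s i) (s₂ := I.biUnion s) (f := f)
    have h2 : 0 ≤ ∑ a ∈ s i ∩ I.biUnion s, f a := Finset.sum_nonneg fun a _ => hf a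
    linarith

open Classical in
/-- The marginal distribution of one channel output among `N` independent ones. -/
lemma sum_filter_prod_prob {A B : Fin N → Type*} [∀ j, Fintype (B j)]
    (V : ∀ j, Channel (A j) (B j)) (x : ∀ j, A j) (j : Fin N) (s : Finset (B j)) :
    ∑ y : (∀ j, B j) with y j ∈ s, ∏ k, (V k).prob (x k) (y k) = ∑ b ∈ s, (V j).prob (x j) b := by
  have h := Finset.prod_univ_sum
    (Function.update (fun k => (Finset.univ : Finset (B k))) j s)
    (fun k b => (V k).prob (x k) b)
  have hs : Fintype.piFinset (Function.update (fun k => (Finset.univ : Finset (B k))) j s)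
      = Finset.univ.filter fun y : (∀ j, B j) => y j ∈ s := by
    ext y
    simp only [Fintype.mem_piFinset, Finset.mem_filter, Finset.mem_univ, true_and]
    constructor
    · intro hy; simpa using hy j
    · intro hy k
      by_cases hk : k = j
      · subst hk; simpa using hy
      · simp [hk]
  rw [hs] at h
  rw [← h, Finset.prod_eq_single j]
  · simp
  · intro k _ hk
    simp [hk, (V k).prob_sum]
  · simp

/-- The error probability is at most the sum of those of the channel codes. -/
lemma scheme_errorProb_le [∀ j, Fintype (Y j)] (hL₀ : 0 < L₀) (W : ∀ j, Channel (X j) (Y j))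
    (enc : ∀ j, (P.Item j → Fin (bitsPerSymbol L L₀) → ZMod 2) → Fin (t j) → X j)
    (dec : ∀ j, (Fin (t j) → Y j) → P.Item j → Fin (bitsPerSymbol L L₀) → ZMod 2)
    {ε : Fin N → ℝ} [∀ j a, DecidablePred fun y => dec j y ≠ a]
    (h : ∀ j a, ∑ y with dec j y ≠ a, ((W j).block (t j)).prob (enc j a) y ≤ ε j) (i : Fin M) :
    (P.scheme L t enc dec).errorProb W i ≤ ∑ j, ε j := by
  classical
  have hε : 0 ≤ ∑ j, ε j := Finset.sum_nonneg fun j _ =>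
    (Finset.sum_nonneg fun y _ => Channel.prob_nonneg _ _ _).trans (h j 0)
  have key : ∀ (w : Messages M L) (π : Fin M → Equiv.Perm (Fin L₀)),
      ∑ y : (∀ j, Fin (t j) → Y j) with
          (P.scheme L t enc dec).decode i (P.query i π) y ≠ w i,
        ∏ j, ∏ η, (W j).prob (enc j (P.symbols (P.query i π j) fun m => pad L₀ (w m)) η)
          (y j η) ≤ ∑ j, ε j := by
    intro w π
    set a : ∀ j, P.Item j → Fin (bitsPerSymbol L L₀) → ZMod 2 :=
      fun j => P.symbols (P.query i π j) fun m => pad L₀ (w m) with ha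
    have hex : ∀ y : (∀ j, Fin (t j) → Y j),
        (P.scheme L t enc dec).decode i (P.query i π) y ≠ w i → ∃ j, dec j (y j) ≠ a j := by
      intro y hy
      by_contra! hcon
      apply hy
      have hex : ∃ w' : Messages M L, ∀ j,
          P.symbols (P.query i π j) (fun m => pad L₀ (w' m)) = dec j (y j) :=
        ⟨w, fun j => (hcon j).symm⟩
      have hch : (P.scheme L t enc dec).decode i (P.query i π) y = hex.choose i := dif_pos hex
      rw [hch]
      refine pad_injective hL₀ (P.eq_of_symbols_eq (i := i) (π := π)
        (u := fun m => pad L₀ (hex.choose m)) (u' := fun m => pad L₀ (w m)) fun j => ?_)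
      rw [hex.choose_spec j, hcon j]
    have hmem : ∀ (y : ∀ j, Fin (t j) → Y j) (j : Fin N), dec j (y j) ≠ a j →
        y ∈ Finset.univ.biUnion fun j => Finset.univ.filter fun y : (∀ j, Fin (t j) → Y j) =>
          y j ∈ Finset.univ.filter fun b => dec j b ≠ a j := by
      intro y j hj
      simp only [Finset.mem_biUnion, Finset.mem_filter, Finset.mem_univ, true_and]
      exact ⟨j, hj⟩
    refine le_trans (b := ∑ y ∈ Finset.univ.biUnion fun j =>
            Finset.univ.filter fun y : (∀ j, Fin (t j) → Y j) =>
              y j ∈ Finset.univ.filter fun b => dec j b ≠ a j,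
          ∏ j, ((W j).block (t j)).prob (enc j (a j)) (y j)) ?_ ?_
    · refine Finset.sum_le_sum_of_subset_of_nonneg (fun y hy => ?_) fun y _ _ =>
        Finset.prod_nonneg fun j _ => ((W j).block (t j)).prob_nonneg _ _
      obtain ⟨j, hj⟩ := hex y (Finset.mem_filter.mp hy).2
      exact hmem y j hj
    calc ∑ y ∈ Finset.univ.biUnion fun j =>
            Finset.univ.filter fun y : (∀ j, Fin (t j) → Y j) =>
              y j ∈ Finset.univ.filter fun b => dec j b ≠ a j,
          ∏ j, ((W j).block (t j)).prob (enc j (a j)) (y j)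
      _ ≤ ∑ j, ∑ y : (∀ j, Fin (t j) → Y j) with
            y j ∈ Finset.univ.filter fun b => dec j b ≠ a j,
          ∏ j, ((W j).block (t j)).prob (enc j (a j)) (y j) :=
          sum_biUnion_le _ _ _ fun y =>
            Finset.prod_nonneg fun j _ => Channel.prob_nonneg _ _ _
      _ ≤ ∑ j, ε j := Finset.sum_le_sum fun j _ => by
          refine (le_of_eq ?_).trans (h j (a j))
          convert sum_filter_prod_prob (fun j => (W j).block (t j)) (fun j => enc j (a j)) j _
  have hw : ∀ w : Messages M L, ∑ q, (P.scheme L t enc dec).jointProb i w q *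
      ∑ y with (P.scheme L t enc dec).decode i q y ≠ w i,
        ∏ j, ∏ η, (W j).prob ((P.scheme L t enc dec).answer j (q j) w η) (y j η)
      ≤ (Fintype.card (Messages M L) : ℝ)⁻¹ * ∑ j, ε j := by
    intro w
    simp only [Scheme.jointProb, mul_assoc]
    rw [← Finset.mul_sum]
    refine mul_le_mul_of_nonneg_left ?_ (by positivity)
    have h1 := P.sum_queryProb_mul i fun q =>
      ∑ y : (∀ j, Fin (t j) → Y j) with (P.scheme L t enc dec).decode i q y ≠ w i,
        ∏ j, ∏ η, (W j).prob (enc j (P.symbols (q j) fun m => pad L₀ (w m)) η) (y j η)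
    refine (le_of_eq ?_).trans (h1.le.trans ?_)
    · exact Finset.sum_congr (by congr!) fun q _ => rfl
    · rw [inv_mul_le_iff₀ (by exact_mod_cast Fintype.card_pos), ← nsmul_eq_mul,
        ← Finset.card_univ, ← Finset.sum_const]
      exact Finset.sum_le_sum fun π _ => key w π
  calc (P.scheme L t enc dec).errorProb W i
      ≤ ∑ _w : Messages M L, (Fintype.card (Messages M L) : ℝ)⁻¹ * ∑ j, ε j :=
        Finset.sum_le_sum fun w _ => by convert hw w
    _ = ∑ j, ε j := by
        rw [Finset.sum_const, Finset.card_univ, nsmul_eq_mul, ← mul_assoc,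
          mul_inv_cancel₀ (by exact_mod_cast Fintype.card_ne_zero), one_mul]

end Pattern

/-! ### Retrieval patterns from stage counts -/

/-- A download: the set of messages whose symbols are added, and the number of the stage. -/
abbrev Download (M : ℕ) : Type := (_ : Finset (Fin M)) × ℕ

/-- The downloads from a database which uses `c k` stages for each set of `k` messages. -/
def downloads (M : ℕ) (c : ℕ → ℕ) : Finset (Download M) :=
  Finset.univ.sigma fun T => Finset.range (c T.card)

/-- The positions of message `m` in the pattern with `y j k` stages of sums of `k` symbols at
database `j`: one for every download which involves message `m`. -/
def slots {M N : ℕ} (y : Fin N → ℕ → ℕ) (m : Fin M) : Finset ((_ : Fin N) × Download M) :=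
  Finset.univ.sigma fun j => (Finset.univ.filter fun T => m ∈ T).sigma fun T =>
    Finset.range (y j T.card)

lemma mem_downloads {M : ℕ} {c : ℕ → ℕ} {x : Download M} :
    x ∈ downloads M c ↔ x.2 < c x.1.card := by
  simp [downloads]

lemma mem_slots {M N : ℕ} {y : Fin N → ℕ → ℕ} {m : Fin M} {z : (_ : Fin N) × Download M} :
    z ∈ slots y m ↔ m ∈ z.2.1 ∧ z.2.2 < y z.1 z.2.1.card := by
  simp [slots]

lemma card_downloads {M : ℕ} {c : ℕ → ℕ} (hc : c 0 = 0) :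
    (downloads M c).card = ∑ k ∈ Finset.Icc 1 M, M.choose k * c k := by
  have h := Finset.sum_powerset_apply_card c (x := (Finset.univ : Finset (Fin M)))
  rw [downloads, Finset.card_sigma]
  simp only [Finset.card_range]
  rw [Finset.powerset_univ] at h
  rw [h, Finset.card_univ, Fintype.card_fin, Finset.range_eq_Ico,
    Finset.sum_eq_sum_Ico_succ_bot (Nat.succ_pos M), hc]
  simp [Finset.Ico_add_one_right_eq_Icc]

lemma sum_filter_mem_card {M : ℕ} (c : ℕ → ℕ) (m : Fin M) :
    ∑ T : Finset (Fin M) with m ∈ T, c T.card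
      = ∑ k ∈ Finset.Icc 1 M, (M - 1).choose (k - 1) * c k := by
  have hM : M - 1 + 1 = M := Nat.succ_pred_eq_of_pos m.pos
  have h := Finset.sum_powerset_apply_card (fun k => c (k + 1)) (x := Finset.univ.erase m)
  rw [Finset.card_erase_of_mem (Finset.mem_univ m), Finset.card_univ, Fintype.card_fin, hM] at h
  have h1 : ∑ T : Finset (Fin M) with m ∈ T, c T.card
      = ∑ T ∈ (Finset.univ.erase m).powerset, c (T.card + 1) := by
    refine Finset.sum_nbij' (fun T => T.erase m) (fun T => insert m T) ?_ ?_ ?_ ?_ ?_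
    · intro T _
      exact Finset.mem_powerset.mpr (Finset.erase_subset_erase _ (Finset.subset_univ _))
    · intro T _; simp
    · intro T hT
      exact Finset.insert_erase (by simpa using hT)
    · intro T hT
      refine Finset.erase_insert fun hm => ?_
      simpa using Finset.mem_powerset.mp hT hm
    · intro T hT
      rw [Finset.card_erase_add_one (by simpa using hT)]
  rw [h1, h, ← Finset.Ico_add_one_right_eq_Icc, Finset.sum_Ico_eq_sum_range]
  simp [add_comm 1]

lemma card_slots {M N : ℕ} (y : Fin N → ℕ → ℕ) (m : Fin M) :
    (slots y m).card = ∑ j, ∑ k ∈ Finset.Icc 1 M, (M - 1).choose (k - 1) * y j k := by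
  simp only [slots, Finset.card_sigma, Finset.card_range, ← sum_filter_mem_card _ m]

/-- The conditions on the numbers `y j k` of stages under which there is enough side information.
Database `j` starts with sums of `lev j + 1` symbols. The databases in `G` provide single symbols;
a database with `lev j ≥ 2` draws side information for its first sums from `ξ j` sums of `lev j`
such symbols per database of `G`, as well as from the downloads from the other databases. -/
structure IsFeasible (M : ℕ) {N : ℕ} (y : Fin N → ℕ → ℕ) (lev ξ : Fin N → ℕ)
    (G : Finset (Fin N)) : Prop where
  eq_zero : ∀ j k, k ≤ lev j → y j k = 0
  lev_eq_zero : ∀ j ∈ G, lev j = 0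
  succ_le : ∀ j k, 1 ≤ k → y j (k + 1) ≤ ∑ j' ∈ Finset.univ.erase j, y j' k +
    if 2 ≤ lev j ∧ k = lev j then G.card * ξ j else 0
  le_single : ∀ j, 2 ≤ lev j → ∀ j' ∈ G, (M - 2).choose (lev j - 1) * ξ j ≤ y j' 1

lemma exists_injOn_of_card_le {α β : Type*} [Nonempty β] {s : Finset α} {t : Finset β}
    (h : s.card ≤ t.card) : ∃ f : α → β, (∀ a ∈ s, f a ∈ t) ∧ Set.InjOn f s := by
  obtain ⟨f, hf, hinj⟩ := s.finite_toSet.exists_injOn_of_encard_le (t := (t : Set β))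
    (by simpa using h)
  exact ⟨f, fun a ha => hf ha, hinj⟩

section

variable {M N : ℕ} {y : Fin N → ℕ → ℕ} {lev ξ : Fin N → ℕ} {G : Finset (Fin N)}

/-- The side information used in the stages of sums of `k + 1` symbols at database `j`: a stage of
sums of `k` symbols at another database, or a sum of single symbols. -/
lemma IsFeasible.exists_source (h : IsFeasible M y lev ξ G) (j : Fin N) (k : ℕ) :
    ∃ φ : ℕ → ((_ : Fin N) × ℕ) ⊕ ((_ : Fin N) × ℕ), 1 ≤ k →
      Set.InjOn φ (Finset.range (y j (k + 1))) ∧ ∀ s < y j (k + 1),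
        (∀ z, φ s = Sum.inl z → z.1 ≠ j ∧ z.2 < y z.1 k) ∧
        (∀ z, φ s = Sum.inr z → (2 ≤ lev j ∧ k = lev j) ∧ z.1 ∈ G ∧ z.2 < ξ j) := by
  by_cases hk : 1 ≤ k
  swap
  · exact ⟨fun _ => Sum.inl ⟨j, 0⟩, fun h => absurd h hk⟩
  have : Nonempty (((_ : Fin N) × ℕ) ⊕ ((_ : Fin N) × ℕ)) := ⟨Sum.inl ⟨j, 0⟩⟩
  obtain ⟨φ, hφ, hinj⟩ := exists_injOn_of_card_le (s := Finset.range (y j (k + 1)))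
    (t := ((Finset.univ.erase j).sigma fun j' => Finset.range (y j' k)).disjSum
      (if 2 ≤ lev j ∧ k = lev j then G.sigma fun _ => Finset.range (ξ j) else ∅)) (by
      rw [Finset.card_disjSum, Finset.card_range, Finset.card_sigma]
      refine (h.succ_le j k hk).trans (le_of_eq ?_)
      split_ifs <;> simp)
  refine ⟨φ, fun _ => ⟨hinj, fun s hs => ⟨fun z hz => ?_, fun z hz => ?_⟩⟩⟩
  · have := hφ s (Finset.mem_range.mpr hs)
    rw [hz, Finset.inl_mem_disjSum] at this
    simpa using this
  · have := hφ s (Finset.mem_range.mpr hs)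
    rw [hz, Finset.inr_mem_disjSum] at this
    split_ifs at this with hc
    · exact ⟨hc, by simpa using this⟩
    · simp at this

lemma card_filter_le_choose {i m : Fin M} (hmi : m ≠ i) (l : ℕ) :
    (Finset.univ.filter fun T : Finset (Fin M) => i ∉ T ∧ m ∈ T ∧ T.card = l).card
      ≤ (M - 2).choose (l - 1) := by
  have h2 : ((Finset.univ.erase i).erase m).card = M - 2 := by
    rw [Finset.card_erase_of_mem (by simpa using hmi),
      Finset.card_erase_of_mem (Finset.mem_univ i), Finset.card_univ, Fintype.card_fin,
      Nat.sub_sub]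
  rw [← h2, ← Finset.card_powersetCard]
  refine Finset.card_le_card_of_injOn (fun T => T.erase m) ?_ ?_
  · intro T hT
    obtain ⟨hi, hm, hl⟩ := (Finset.mem_filter.mp hT).2
    refine Finset.mem_coe.mpr (Finset.mem_powersetCard.mpr ⟨?_, ?_⟩)
    · refine Finset.erase_subset_erase _ fun a ha => ?_
      exact Finset.mem_erase.mpr ⟨fun h => hi (h ▸ ha), Finset.mem_univ a⟩
    · rw [Finset.card_erase_of_mem hm, hl]
  · intro T hT T' hT' hTT
    have hm := (Finset.mem_filter.mp hT).2.2.1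
    have hm' := (Finset.mem_filter.mp hT').2.2.1
    rw [← Finset.insert_erase hm, ← Finset.insert_erase hm']
    exact congrArg _ hTT

/-- The single symbols of message `m` which enter the sums of `lev j` single symbols. -/
lemma IsFeasible.exists_single (h : IsFeasible M y lev ξ G) (j j' : Fin N) (i m : Fin M) :
    ∃ ψ : Download M → ℕ, 2 ≤ lev j → j' ∈ G → m ≠ i →
      (∀ x : Download M, i ∉ x.1 → m ∈ x.1 → x.1.card = lev j → x.2 < ξ j → ψ x < y j' 1) ∧
      Set.InjOn ψ {x | i ∉ x.1 ∧ m ∈ x.1 ∧ x.1.card = lev j ∧ x.2 < ξ j} := by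
  by_cases hc : 2 ≤ lev j ∧ j' ∈ G ∧ m ≠ i
  swap
  · exact ⟨fun _ => 0, fun h1 h2 h3 => absurd ⟨h1, h2, h3⟩ hc⟩
  obtain ⟨h1, h2, h3⟩ := hc
  obtain ⟨ψ, hψ, hinj⟩ := exists_injOn_of_card_le
    (s := (Finset.univ.filter fun T : Finset (Fin M) => i ∉ T ∧ m ∈ T ∧ T.card = lev j).sigma
      fun _ => Finset.range (ξ j))
    (t := Finset.range (y j' 1)) (by
      rw [Finset.card_sigma, Finset.sum_const, Finset.card_range, Finset.card_range, smul_eq_mul]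
      exact (Nat.mul_le_mul_right _ (card_filter_le_choose h3 _)).trans (h.le_single j h1 j' h2))
  refine ⟨ψ, fun _ _ _ => ⟨fun x hi hm hx hs => ?_, ?_⟩⟩
  · exact Finset.mem_range.mp (hψ x (by simp [hi, hm, hx, hs]))
  · refine hinj.mono fun x hx => ?_
    obtain ⟨hi, hm, hx, hs⟩ := hx
    simp [hi, hm, hx, hs]

/-- Every summand of every download can be given a position, in such a way that a database never
uses a position twice. A symbol is fresh if its message is desired or if the download does not
involve the desired message `i`. In the downloads which involve message `i`, the other summands
form side information: together they are a download from another database, or each of them is. -/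
lemma IsFeasible.exists_address (h : IsFeasible M y lev ξ G) :
    ∃ α : Fin M → Fin N → Fin M → Download M → (_ : Fin N) × Download M,
      (∀ i j m, ∀ x ∈ downloads M (y j), m ∈ x.1 → α i j m x ∈ slots y m) ∧
      (∀ i j m, Set.InjOn (α i j m) {x | x ∈ downloads M (y j) ∧ m ∈ x.1}) ∧
      (∀ i j m, ∀ x : Download M, m = i ∨ i ∉ x.1 → α i j m x = ⟨j, x⟩) ∧
      (∀ i j, ∀ x ∈ downloads M (y j), i ∈ x.1 →
        (∃ j' s, s < y j' (x.1.erase i).card ∧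
          ∀ m ∈ x.1.erase i, α i j m x = ⟨j', x.1.erase i, s⟩) ∨
        ∀ m ∈ x.1.erase i, ∃ j' s, s < y j' 1 ∧ α i j m x = ⟨j', {m}, s⟩) := by
  choose φ hφ using h.exists_source
  choose ψ hψ using h.exists_single
  let α : Fin M → Fin N → Fin M → Download M → (_ : Fin N) × Download M := fun i j m x =>
    if m = i ∨ i ∉ x.1 then ⟨j, x⟩
    else match φ j (x.1.erase i).card x.2 with
      | Sum.inl z => ⟨z.1, x.1.erase i, z.2⟩
      | Sum.inr z => ⟨z.1, {m}, ψ j z.1 i m ⟨x.1.erase i, z.2⟩⟩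
  have hfresh : ∀ i j m, ∀ x : Download M, m = i ∨ i ∉ x.1 → α i j m x = ⟨j, x⟩ :=
    fun i j m x hx => if_pos hx
  have hinl : ∀ i j m, ∀ x : Download M, ¬ (m = i ∨ i ∉ x.1) → ∀ z,
      φ j (x.1.erase i).card x.2 = Sum.inl z → α i j m x = ⟨z.1, x.1.erase i, z.2⟩ := by
    intro i j m x hx z hz
    simp only [α, if_neg hx, hz]
  have hinr : ∀ i j m, ∀ x : Download M, ¬ (m = i ∨ i ∉ x.1) → ∀ z,
      φ j (x.1.erase i).card x.2 = Sum.inr z →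
        α i j m x = ⟨z.1, {m}, ψ j z.1 i m ⟨x.1.erase i, z.2⟩⟩ := by
    intro i j m x hx z hz
    simp only [α, if_neg hx, hz]
  -- the properties of the side information for a download that involves `i` and `m ≠ i`
  have hside : ∀ i j m, ∀ x ∈ downloads M (y j), m ∈ x.1 → ¬ (m = i ∨ i ∉ x.1) →
      m ∈ x.1.erase i ∧ 1 ≤ (x.1.erase i).card ∧ x.2 < y j ((x.1.erase i).card + 1) := by
    intro i j m x hx hm hmi
    push Not at hmi
    have hme : m ∈ x.1.erase i := Finset.mem_erase.mpr ⟨hmi.1, hm⟩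
    refine ⟨hme, Finset.card_pos.mpr ⟨m, hme⟩, ?_⟩
    rw [Finset.card_erase_add_one hmi.2]
    exact mem_downloads.mp hx
  -- a summand that is not fresh comes from another database
  have hother : ∀ i j m, ∀ x ∈ downloads M (y j), m ∈ x.1 → ¬ (m = i ∨ i ∉ x.1) →
      (α i j m x).1 ≠ j := by
    intro i j m x hx hm hmi
    obtain ⟨hme, hk, hs⟩ := hside i j m x hx hm hmi
    obtain ⟨hl, hr⟩ := (hφ j _ hk).2 _ hs
    rcases hz : φ j (x.1.erase i).card x.2 with z | z
    · rw [hinl i j m x hmi z hz]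
      exact (hl z hz).1
    · rw [hinr i j m x hmi z hz]
      obtain ⟨⟨hlev, -⟩, hG, -⟩ := hr z hz
      intro hzj
      have h0 := h.lev_eq_zero _ hG
      simp only at hzj
      rw [hzj] at h0
      omega
  refine ⟨α, ?_, ?_, hfresh, ?_⟩
  · intro i j m x hx hm
    by_cases hmi : m = i ∨ i ∉ x.1
    · rw [hfresh i j m x hmi]
      exact mem_slots.mpr ⟨hm, mem_downloads.mp hx⟩
    obtain ⟨hme, hk, hs⟩ := hside i j m x hx hm hmi
    obtain ⟨hl, hr⟩ := (hφ j _ hk).2 _ hs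
    rcases hz : φ j (x.1.erase i).card x.2 with z | z
    · rw [hinl i j m x hmi z hz]
      exact mem_slots.mpr ⟨hme, (hl z hz).2⟩
    · rw [hinr i j m x hmi z hz]
      obtain ⟨⟨hlev, hklev⟩, hG, hξ⟩ := hr z hz
      refine mem_slots.mpr ⟨Finset.mem_singleton_self m, ?_⟩
      simpa using (hψ j z.1 i m hlev hG (not_or.mp hmi).1).1 ⟨x.1.erase i, z.2⟩
        (Finset.notMem_erase _ _) hme hklev hξ
  · rintro i j m x ⟨hx, hm⟩ x' ⟨hx', hm'⟩ hxx
    by_cases hmi : m = i ∨ i ∉ x.1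
    · by_cases hmi' : m = i ∨ i ∉ x'.1
      · rw [hfresh i j m x hmi, hfresh i j m x' hmi'] at hxx
        simpa using hxx
      · refine absurd ?_ (hother i j m x' hx' hm' hmi')
        rw [← hxx, hfresh i j m x hmi]
    by_cases hmi' : m = i ∨ i ∉ x'.1
    · refine absurd ?_ (hother i j m x hx hm hmi)
      rw [hxx, hfresh i j m x' hmi']
    obtain ⟨hme, hk, hs⟩ := hside i j m x hx hm hmi
    obtain ⟨hl, hr⟩ := (hφ j _ hk).2 _ hs
    obtain ⟨hme', hk', hs'⟩ := hside i j m x' hx' hm' hmi'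
    obtain ⟨hl', hr'⟩ := (hφ j _ hk').2 _ hs'
    have hfin : x.1.erase i = x'.1.erase i →
        φ j (x.1.erase i).card x.2 = φ j (x'.1.erase i).card x'.2 → x = x' := by
      intro he hφe
      rw [← he] at hφe hs'
      have h2 : x.2 = x'.2 := (hφ j _ hk).1 (by simpa using hs) (by simpa using hs') hφe
      have h1 : x.1 = x'.1 := by
        rw [← Finset.insert_erase (not_not.mp (not_or.mp hmi).2), he,
          Finset.insert_erase (not_not.mp (not_or.mp hmi').2)]
      exact Sigma.ext h1 (heq_of_eq h2)
    -- a database that uses single symbols has no stage of sums of two symbols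
    have hmix : ∀ x₁ ∈ downloads M (y j), m ∈ x₁.1 → ¬ (m = i ∨ i ∉ x₁.1) → 2 ≤ lev j →
        x₁.1.erase i ≠ {m} := by
      intro x₁ hx₁ hm₁ hmi₁ hlev he
      obtain ⟨-, -, hs₁⟩ := hside i j m x₁ hx₁ hm₁ hmi₁
      rw [he, Finset.card_singleton, h.eq_zero j _ hlev] at hs₁
      omega
    rcases hz : φ j (x.1.erase i).card x.2 with z | z <;>
      rcases hz' : φ j (x'.1.erase i).card x'.2 with z' | z'
    · rw [hinl i j m x hmi z hz, hinl i j m x' hmi' z' hz'] at hxx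
      simp only [Sigma.mk.injEq, heq_eq_eq] at hxx
      refine hfin hxx.2.1 ?_
      rw [hz, hz']
      exact congrArg _ (Sigma.ext hxx.1 (heq_of_eq hxx.2.2))
    · rw [hinl i j m x hmi z hz, hinr i j m x' hmi' z' hz'] at hxx
      simp only [Sigma.mk.injEq, heq_eq_eq] at hxx
      exact absurd hxx.2.1 (hmix x hx hm hmi (hr' z' hz').1.1)
    · rw [hinr i j m x hmi z hz, hinl i j m x' hmi' z' hz'] at hxx
      simp only [Sigma.mk.injEq, heq_eq_eq] at hxx
      exact absurd hxx.2.1.symm (hmix x' hx' hm' hmi' (hr z hz).1.1)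
    · rw [hinr i j m x hmi z hz, hinr i j m x' hmi' z' hz'] at hxx
      simp only [Sigma.mk.injEq, heq_eq_eq, true_and] at hxx
      obtain ⟨⟨hlev, hklev⟩, hG, hξ⟩ := hr z hz
      obtain ⟨⟨-, hklev'⟩, -, hξ'⟩ := hr' z' hz'
      obtain ⟨h1, h2⟩ := hxx
      rw [← h1] at h2
      have h3 := (hψ j z.1 i m hlev hG (not_or.mp hmi).1).2
        ⟨Finset.notMem_erase _ _, hme, hklev, hξ⟩
        ⟨Finset.notMem_erase _ _, hme', hklev', hξ'⟩ h2
      simp only [Sigma.mk.injEq, heq_eq_eq] at h3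
      refine hfin h3.1 ?_
      rw [hz, hz']
      exact congrArg _ (Sigma.ext h1 (heq_of_eq h3.2))
  · intro i j x hx hi
    have hmi : ∀ m ∈ x.1.erase i, ¬ (m = i ∨ i ∉ x.1) := fun m hm hor =>
      hor.elim (Finset.ne_of_mem_erase hm) fun hn => hn hi
    rcases (x.1.erase i).eq_empty_or_nonempty with he | ⟨m₀, hm₀⟩
    · right; simp [he]
    obtain ⟨-, hk, hs⟩ := hside i j m₀ x hx (Finset.mem_of_mem_erase hm₀) (hmi m₀ hm₀)
    obtain ⟨hl, hr⟩ := (hφ j _ hk).2 _ hs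
    rcases hz : φ j (x.1.erase i).card x.2 with z | z
    · exact Or.inl ⟨z.1, z.2, (hl z hz).2, fun m hm => hinl i j m x (hmi m hm) z hz⟩
    · refine Or.inr fun m hm => ⟨z.1, _, ?_, hinr i j m x (hmi m hm) z hz⟩
      obtain ⟨⟨hlev, hklev⟩, hG, hξ⟩ := hr z hz
      exact (hψ j z.1 i m hlev hG (Finset.ne_of_mem_erase hm)).1 _
        (Finset.notMem_erase _ _) hm hklev hξ

/-- Feasible stage counts are those of a retrieval pattern. -/
theorem IsFeasible.exists_pattern (h : IsFeasible M y lev ξ G) {L₀ : ℕ}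
    (hL₀ : ∑ j, ∑ k ∈ Finset.Icc 1 M, (M - 1).choose (k - 1) * y j k = L₀) :
    ∃ P : Pattern M N L₀, ∀ j,
      Fintype.card (P.Item j) = ∑ k ∈ Finset.Icc 1 M, M.choose k * y j k := by
  classical
  obtain ⟨α, hmem, hinj, hfresh, hside⟩ := h.exists_address
  let e : ∀ m, slots y m ≃ Fin L₀ := fun m =>
    Finset.equivFinOfCardEq ((card_slots y m).trans hL₀)
  let pos : ∀ (_ : Fin M) (j : Fin N) (m : Fin M),
      {x : downloads M (y j) // m ∈ x.1.1} → Fin L₀ := fun i j m x =>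
    e m ⟨α i j m x.1, hmem i j m x.1 x.1.2 x.2⟩
  have hpos : ∀ i j m, Function.Injective (pos i j m) := by
    intro i j m x x' hxx
    have h1 := congrArg Subtype.val ((e m).injective hxx)
    exact Subtype.ext (Subtype.ext (hinj i j m ⟨x.1.2, x.2⟩ ⟨x'.1.2, x'.2⟩ h1))
  refine ⟨{
    Item := fun j => downloads M (y j)
    place := fun i j m x => if hx : m ∈ x.1.1 then some (pos i j m ⟨x, hx⟩) else none
    exists_perm := ?_
    decodable := ?_ }, fun j => ?_⟩
  · intro i i' j m
    obtain ⟨σ, hσ⟩ := Equiv.Perm.exists_extending_pair _ _ (hpos i j m) (hpos i' j m)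
    refine ⟨σ, fun x => ?_⟩
    by_cases hx : m ∈ x.1.1
    · simp only [dif_pos hx, Option.map_some, hσ]
    · simp only [dif_neg hx, Option.map_none]
  · intro i V _ u hu
    -- the downloads as sums over sets of messages
    let w : Fin M → (_ : Fin N) × Download M → V := fun m z =>
      if hz : z ∈ slots y m then u m (e m ⟨z, hz⟩) else 0
    have hw : ∀ j, ∀ x ∈ downloads M (y j), ∑ m ∈ x.1, w m (α i j m x) = 0 := by
      intro j x hx
      rw [← hu j ⟨x, hx⟩, ← Finset.sum_subset (Finset.subset_univ x.1)]
      · refine Finset.sum_congr rfl fun m hm => ?_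
        simp only [dif_pos hm, Option.elim_some, w, dif_pos (hmem i j m x hx hm), pos]
      · intro m _ hm
        simp only [dif_neg hm, Option.elim_none]
    have hw0 : ∀ z ∈ slots y i, w i z = 0 := by
      rintro ⟨j, x⟩ hz
      obtain ⟨hi, hs⟩ := mem_slots.mp hz
      have hx : x ∈ downloads M (y j) := mem_downloads.mpr hs
      have h0 := hw j x hx
      rw [← Finset.add_sum_erase _ _ hi, hfresh i j i x (Or.inl rfl)] at h0
      suffices h1 : ∑ m ∈ x.1.erase i, w m (α i j m x) = 0 by rwa [h1, add_zero] at h0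
      rcases hside i j x hx hi with ⟨j', s, hs', hα⟩ | hα
      · rw [← hw j' ⟨x.1.erase i, s⟩ (mem_downloads.mpr hs')]
        refine Finset.sum_congr rfl fun m hm => ?_
        rw [hα m hm, hfresh i j' m _ (Or.inr (Finset.notMem_erase _ _))]
      · refine Finset.sum_eq_zero fun m hm => ?_
        obtain ⟨j', s, hs', hαm⟩ := hα m hm
        have h2 := hw j' ⟨{m}, s⟩ (mem_downloads.mpr (by simpa using hs'))
        rw [Finset.sum_singleton, hfresh i j' m _ (Or.inr ?_)] at h2
        · rw [hαm, h2]
        · simpa using (Finset.ne_of_mem_erase hm).symm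
    funext p
    have h3 := hw0 _ ((e i).symm p).2
    simp only [w, dif_pos ((e i).symm p).2] at h3
    simpa using h3
  · rw [Fintype.card_coe]
    exact card_downloads (h.eq_zero j 0 (Nat.zero_le _))

end

/-! ### The stage counts of the theorem -/

section StageCounts

variable {M N : ℕ} {n : Fin M → ℕ}

lemma eq_of_mem_group (hn : Monotone n) {j : Fin N} {ℓ ℓ' : Fin M} (h : j ∈ group N n ℓ)
    (h' : j ∈ group N n ℓ') : ℓ = ℓ' := by
  have key : ∀ {ℓ ℓ' : Fin M}, j ∈ group N n ℓ → j ∈ group N n ℓ' → ¬ ℓ < ℓ' := by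
    intro ℓ ℓ' h h' hlt
    simp only [group, Finset.mem_filter, Finset.mem_univ, true_and] at h h'
    have hlt' : (ℓ : ℕ) < ℓ' := hlt
    have h0 : (ℓ' : ℕ) ≠ 0 := by omega
    have h1 : n ℓ ≤ prev n ℓ' := by
      rw [prev, if_neg h0]
      exact hn (Fin.le_def.mpr (by simp only; omega))
    omega
  exact le_antisymm (not_lt.mp (key h' h)) (not_lt.mp (key h h'))

lemma mem_groupIndices_of_mem_group {j : Fin N} {ℓ : Fin M} (h : j ∈ group N n ℓ) :
    ℓ ∈ groupIndices n := by
  simp only [group, groupIndices, Finset.mem_filter, Finset.mem_univ, true_and] at h ⊢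
  omega

lemma filter_mem_group_eq_singleton (hn : Monotone n) {j : Fin N} {ℓ : Fin M}
    (h : j ∈ group N n ℓ) : {ℓ ∈ groupIndices n | j ∈ group N n ℓ} = {ℓ} := by
  ext ℓ'
  simp only [Finset.mem_filter, Finset.mem_singleton]
  exact ⟨fun h' => eq_of_mem_group hn h'.2 h,
    fun h' => h' ▸ ⟨mem_groupIndices_of_mem_group h, h⟩⟩

lemma filter_mem_group_eq (hn : Monotone n) (j : Fin N) :
    {ℓ ∈ groupIndices n | j ∈ group N n ℓ} = ∅ ∨
      ∃ ℓ, j ∈ group N n ℓ ∧ {ℓ ∈ groupIndices n | j ∈ group N n ℓ} = {ℓ} := by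
  rcases Finset.eq_empty_or_nonempty {ℓ ∈ groupIndices n | j ∈ group N n ℓ} with h | ⟨ℓ, hℓ⟩
  · exact Or.inl h
  · have h := (Finset.mem_filter.mp hℓ).2
    exact Or.inr ⟨ℓ, h, filter_mem_group_eq_singleton hn h⟩

lemma card_group (ℓ : Fin M) (h : n ℓ ≤ N) : (group N n ℓ).card = groupSize n ℓ := by
  rw [groupSize, ← Nat.card_Ico, ← Finset.card_image_of_injective _ Fin.val_injective]
  congr 1
  ext a
  simp only [group, Finset.mem_image, Finset.mem_filter, Finset.mem_univ, true_and,
    Finset.mem_Ico]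
  exact ⟨fun ⟨j, hj, e⟩ => e ▸ hj, fun ha => ⟨⟨a, by omega⟩, ha, rfl⟩⟩

lemma sum_sum_group {R : Type*} [AddCommMonoid R] (f : Fin M → Fin N → R) :
    ∑ j, ∑ ℓ ∈ groupIndices n with j ∈ group N n ℓ, f ℓ j
      = ∑ ℓ ∈ groupIndices n, ∑ j ∈ group N n ℓ, f ℓ j :=
  Finset.sum_comm' (by simp [and_comm])

lemma stageFactor_pos (s : Fin M) : 0 < stageFactor s := by
  rw [stageFactor]
  split_ifs
  · exact one_pos
  · exact Nat.choose_pos (by omega)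

variable [NeZero M]

/-- The number of stages of sums of `k` symbols at database `j`; it is zero if `j` lies in no
group. -/
def dbStages (n : Fin M → ℕ) (j : Fin N) (k : ℕ) : ℕ :=
  ∑ ℓ ∈ groupIndices n with j ∈ group N n ℓ, stages n k ℓ

lemma stages_eq_zero {k : ℕ} {ℓ : Fin M} (h : k ≤ ℓ) : stages n k ℓ = 0 := by
  cases k with
  | zero => rw [stages]
  | succ k => rw [stages, if_pos h]

lemma stages_one : stages n 1 0 = ∏ s ∈ groupIndices n, stageFactor s := by
  rw [stages, if_neg (by simp), if_pos rfl]

lemma prev_zero : prev n 0 = 0 := by simp [prev]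

lemma groupSize_zero : groupSize n 0 = n 0 := by simp [groupSize, prev_zero]

lemma zero_mem_groupIndices (h : IsGroupSeq N n) : 0 ∈ groupIndices n := by
  simpa [groupIndices, prev_zero] using Nat.lt_of_succ_le (h.2 0).1

lemma stages_one_pos : 0 < stages n 1 0 := by
  rw [stages_one]
  exact Finset.prod_pos fun s _ => stageFactor_pos s

lemma sum_dbStages (h : IsGroupSeq N n) (k : ℕ) :
    ∑ j : Fin N, dbStages n j k = ∑ ℓ ∈ groupIndices n, groupSize n ℓ * stages n k ℓ := by
  simp only [dbStages, sum_sum_group fun ℓ _ => stages n k ℓ, Finset.sum_const, smul_eq_mul]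
  exact Finset.sum_congr rfl fun ℓ _ => by rw [card_group ℓ (h.2 ℓ).2]

/-- The difference equations for the numbers of stages say that all available side information is
used. -/
lemma isFeasible_dbStages (h : IsGroupSeq N n) :
    IsFeasible M (N := N) (dbStages n)
      (fun j => ∑ ℓ ∈ groupIndices n with j ∈ group N n ℓ, (ℓ : ℕ))
      (fun j => ∑ ℓ ∈ groupIndices n with j ∈ group N n ℓ, xi n ℓ) (group N n 0) where
  eq_zero j k hk := by
    rcases filter_mem_group_eq h.1 j with he | ⟨ℓ, -, he⟩
    · simp [dbStages, he]
    · rw [he, Finset.sum_singleton] at hk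
      rw [dbStages, he, Finset.sum_singleton, stages_eq_zero hk]
  lev_eq_zero j hj := by
    simp [filter_mem_group_eq_singleton h.1 hj]
  succ_le j k hk := by
    rcases filter_mem_group_eq h.1 j with he | ⟨ℓ, hℓ, he⟩
    · simp [dbStages, he]
    have hS := mem_groupIndices_of_mem_group hℓ
    have hsize : 1 ≤ groupSize n ℓ := by
      rw [← card_group ℓ (h.2 ℓ).2]
      exact Finset.card_pos.mpr ⟨j, hℓ⟩
    have hsum := sum_dbStages h k
    have hj : ∀ k, dbStages n j k = stages n k ℓ := fun k => by
      rw [dbStages, he, Finset.sum_singleton]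
    rw [← Finset.add_sum_erase _ _ (Finset.mem_univ j), ← Finset.add_sum_erase _ _ hS, hj] at hsum
    have hsub : groupSize n ℓ * stages n k ℓ
        = stages n k ℓ + (groupSize n ℓ - 1) * stages n k ℓ := by
      obtain ⟨g, hg⟩ := Nat.exists_eq_add_of_le hsize
      rw [hg, Nat.add_sub_cancel_left]
      ring
    rw [he, Finset.sum_singleton, Finset.sum_singleton, hj, card_group 0 (h.2 0).2,
      groupSize_zero, stages]
    split_ifs <;> omega
  le_single j hlev j' hj' := by
    rcases filter_mem_group_eq h.1 j with he | ⟨ℓ, hℓ, he⟩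
    · simp [he] at hlev
    rw [he, Finset.sum_singleton] at hlev
    rw [he, Finset.sum_singleton, Finset.sum_singleton, dbStages,
      filter_mem_group_eq_singleton h.1 hj', Finset.sum_singleton, stages_one,
      ← Finset.mul_prod_erase _ _ (mem_groupIndices_of_mem_group hℓ), stageFactor,
      if_neg (by omega), xi]

theorem exists_pattern (h : IsGroupSeq N n) :
    ∃ P : Pattern M N (desiredSymbols n), ∀ j, Fintype.card (P.Item j)
      = ∑ ℓ ∈ groupIndices n with j ∈ group N n ℓ, groupLoad n ℓ := by
  obtain ⟨P, hP⟩ := (isFeasible_dbStages h).exists_pattern (L₀ := desiredSymbols n) (by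
    simp only [dbStages, Finset.mul_sum]
    have hswap : ∀ j : Fin N, ∑ k ∈ Finset.Icc 1 M,
        ∑ ℓ ∈ groupIndices n with j ∈ group N n ℓ, (M - 1).choose (k - 1) * stages n k ℓ
        = ∑ ℓ ∈ groupIndices n with j ∈ group N n ℓ,
          ∑ k ∈ Finset.Icc 1 M, (M - 1).choose (k - 1) * stages n k ℓ :=
      fun j => Finset.sum_comm
    simp only [hswap, sum_sum_group fun ℓ _ =>
      ∑ k ∈ Finset.Icc 1 M, (M - 1).choose (k - 1) * stages n k ℓ, Finset.sum_const]
    refine Finset.sum_congr rfl fun ℓ _ => ?_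
    rw [card_group ℓ (h.2 ℓ).2, smul_eq_mul, Finset.mul_sum]
    exact Finset.sum_congr rfl fun k _ => mul_comm _ _)
  refine ⟨P, fun j => ?_⟩
  rw [hP]
  simp only [dbStages, groupLoad, Finset.mul_sum]
  exact Finset.sum_comm

lemma desiredSymbols_pos (h : IsGroupSeq N n) : 0 < desiredSymbols n := by
  refine Finset.sum_pos' (fun _ _ => Nat.zero_le _) ⟨0, zero_mem_groupIndices h, ?_⟩
  refine Finset.sum_pos' (fun _ _ => Nat.zero_le _) ⟨1, by simpa using NeZero.one_le, ?_⟩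
  have h1 : 0 < stages n 1 0 := stages_one_pos
  have h2 : 0 < n 0 := (h.2 0).1
  rw [groupSize_zero]
  simp [h1, h2]

lemma groupLoad_zero_pos : 0 < groupLoad n 0 := by
  refine Finset.sum_pos' (fun _ _ => Nat.zero_le _) ⟨1, by simpa using NeZero.one_le, ?_⟩
  simp [stages_one_pos, NeZero.pos M]

lemma codedTraffic_pos (h : IsGroupSeq N n) {C : Fin N → ℝ} (hC : UsesPositive n C) :
    0 < codedTraffic n C := by
  have hnn : ∀ ℓ ∈ groupIndices n, ∀ j ∈ group N n ℓ, 0 ≤ (groupLoad n ℓ : ℝ) / C j :=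
    fun ℓ hℓ j hj => div_nonneg (Nat.cast_nonneg _) (hC ℓ hℓ j hj).le
  have h0 := zero_mem_groupIndices h
  refine Finset.sum_pos' (fun ℓ hℓ => Finset.sum_nonneg (hnn ℓ hℓ)) ⟨0, h0, ?_⟩
  refine Finset.sum_pos (fun j hj => div_pos (Nat.cast_pos.mpr groupLoad_zero_pos) (hC 0 h0 j hj))
    (Finset.card_pos.mp ?_)
  rw [card_group 0 (h.2 0).2, groupSize_zero]
  exact (h.2 0).1

lemma trafficShare_eq (n : Fin M → ℕ) (C : Fin N → ℝ) (j : Fin N) :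
    trafficShare n C j
      = ((∑ ℓ ∈ groupIndices n with j ∈ group N n ℓ, groupLoad n ℓ : ℕ) : ℝ) / C j /
        codedTraffic n C := by
  rw [trafficShare, ← Finset.sum_div, Nat.cast_sum]

lemma codedTraffic_eq (n : Fin M → ℕ) (C : Fin N → ℝ) :
    codedTraffic n C
      = ∑ j, ((∑ ℓ ∈ groupIndices n with j ∈ group N n ℓ, groupLoad n ℓ : ℕ) : ℝ) / C j := by
  rw [codedTraffic, ← sum_sum_group]
  refine Finset.sum_congr rfl fun j _ => ?_
  rw [← Finset.sum_div, Nat.cast_sum]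

lemma trafficShare_mem_stdSimplex (h : IsGroupSeq N n) {C : Fin N → ℝ} (hC : UsesPositive n C) :
    trafficShare n C ∈ stdSimplex ℝ (Fin N) := by
  have hT := codedTraffic_pos h hC
  refine ⟨fun j => div_nonneg (Finset.sum_nonneg fun ℓ hℓ => ?_) hT.le, ?_⟩
  · obtain ⟨h1, h2⟩ := Finset.mem_filter.mp hℓ
    exact div_nonneg (Nat.cast_nonneg _) (hC ℓ h1 j h2).le
  · simp only [trafficShare_eq, ← Finset.sum_div, ← codedTraffic_eq]
    exact div_self hT.ne'

end StageCounts

/-! ### Asymptotics -/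

open Filter

lemma tendsto_bitsPerSymbol {L₀ : ℕ} (h : 0 < L₀) :
    Tendsto (fun L => Pattern.bitsPerSymbol L L₀) atTop atTop :=
  tendsto_atTop_mono (fun L => Nat.le_succ (L / L₀)) (Nat.tendsto_div_const_atTop h.ne')

lemma tendsto_div_bitsPerSymbol {L₀ : ℕ} (h : 0 < L₀) :
    Tendsto (fun L : ℕ => (L : ℝ) / Pattern.bitsPerSymbol L L₀) atTop (nhds L₀) := by
  have hr : Tendsto (fun L => ((Pattern.bitsPerSymbol L L₀ : ℕ) : ℝ)) atTop atTop :=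
    tendsto_natCast_atTop_atTop.comp (tendsto_bitsPerSymbol h)
  have hlow : Tendsto (fun L => (L₀ : ℝ) - L₀ / (Pattern.bitsPerSymbol L L₀ : ℕ)) atTop
      (nhds L₀) := by simpa using (hr.const_div_atTop (L₀ : ℝ)).const_sub (L₀ : ℝ)
  refine tendsto_of_tendsto_of_tendsto_of_le_of_le hlow tendsto_const_nhds (fun L => ?_)
    fun L => ?_
  all_goals
    have hpos : (0 : ℝ) < (Pattern.bitsPerSymbol L L₀ : ℕ) := by
      exact_mod_cast Nat.succ_pos (L / L₀)
  · have h1 : L₀ * Pattern.bitsPerSymbol L L₀ ≤ L + L₀ := by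
      rw [Pattern.bitsPerSymbol, mul_add, mul_one]
      exact Nat.add_le_add_right (Nat.mul_div_le L L₀) L₀
    have h2 : (L₀ : ℝ) * (Pattern.bitsPerSymbol L L₀ : ℕ) ≤ L + L₀ := by exact_mod_cast h1
    dsimp only
    rw [sub_le_iff_le_add, ← add_div, le_div_iff₀ hpos]
    exact h2
  · have h1 : L ≤ L₀ * Pattern.bitsPerSymbol L L₀ := (Nat.lt_mul_div_succ L h).le
    dsimp only
    rw [div_le_iff₀ hpos]
    exact_mod_cast h1

lemma Scheme.errorProb_nonneg {M L N : ℕ} {X : Fin N → Type u} {Y : Fin N → Type v}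
    [∀ j, Fintype (Y j)] (S : Scheme M L X Y) (W : ∀ j, Channel (X j) (Y j)) (i : Fin M) :
    0 ≤ S.errorProb W i :=
  Finset.sum_nonneg fun _ _ => Finset.sum_nonneg fun q _ =>
    mul_nonneg (mul_nonneg (by positivity) (S.queryProb_nonneg i q)) <|
      Finset.sum_nonneg fun _ _ => Finset.prod_nonneg fun _ _ =>
        Finset.prod_nonneg fun _ _ => Channel.prob_nonneg _ _ _

/-- A retrieval pattern together with capacity-achieving codes yields the traffic ratios and the
rate in which each download costs `1 / C j` channel uses per bit. -/
theorem Pattern.achievableAt {M N L₀ : ℕ} {X : Fin N → Type u} {Y : Fin N → Type v}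
    [∀ j, Fintype (X j)] [∀ j, Fintype (Y j)] (P : Pattern M N L₀) (hL₀ : 0 < L₀)
    (W : ∀ j, Channel (X j) (Y j))
    (hC : ∀ j, 0 < (W j).capacity ∨ Fintype.card (P.Item j) = 0)
    (hT : (∑ j, (Fintype.card (P.Item j) : ℝ) / (W j).capacity) ≠ 0) :
    AchievableAt M W
      (fun j => (Fintype.card (P.Item j) : ℝ) / (W j).capacity /
        ∑ k, (Fintype.card (P.Item k) : ℝ) / (W k).capacity)
      (L₀ / ∑ k, (Fintype.card (P.Item k) : ℝ) / (W k).capacity) := by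
  classical
  choose t ε ht hε hcode using fun j => (W j).exists_code_sequence _ (hC j)
  have hcode' : ∀ j r, ((W j).block (t j r)).HasCode (P.Item j → Fin r → ZMod 2) (ε j r) :=
    fun j r => hcode j r _ (by simp [← pow_mul, mul_comm])
  choose enc dec hdec using hcode'
  set r : ℕ → ℕ := fun L => bitsPerSymbol L L₀ with hr
  have hr' : Tendsto r atTop atTop := tendsto_bitsPerSymbol hL₀
  have hrpos : ∀ L, (r L : ℝ) ≠ 0 := fun L =>
    Nat.cast_ne_zero.mpr (Nat.succ_ne_zero (L / L₀))
  have htr : ∀ j, Tendsto (fun L => (t j (r L) : ℝ) / r L) atTop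
      (nhds ((Fintype.card (P.Item j) : ℝ) / (W j).capacity)) := fun j => (ht j).comp hr'
  have htot : Tendsto (fun L => ((∑ j, t j (r L) : ℕ) : ℝ) / r L) atTop
      (nhds (∑ j, (Fintype.card (P.Item j) : ℝ) / (W j).capacity)) := by
    simp only [Nat.cast_sum, Finset.sum_div]
    exact tendsto_finsetSum _ fun j _ => htr j
  refine ⟨fun L => P.scheme L (fun j => t j (r L)) (fun j => enc j (r L)) fun j => dec j (r L),
    fun L => P.scheme_isPrivate _ _, fun i => ?_, fun j => ?_, ?_⟩
  · refine squeeze_zero (fun L => Scheme.errorProb_nonneg _ _ _)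
      (fun L => P.scheme_errorProb_le hL₀ W _ _ (fun j a => by convert hdec j (r L) a) i) ?_
    simpa using tendsto_finsetSum Finset.univ fun j _ => (hε j).comp hr'
  · refine ((htr j).div htot hT).congr fun L => ?_
    exact div_div_div_cancel_right₀ (hrpos L) _ _
  · refine ((tendsto_div_bitsPerSymbol hL₀).div htot hT).congr fun L => ?_
    exact div_div_div_cancel_right₀ (hrpos L) _ _

theorem achievableAt_rate {M N : ℕ} [NeZero M] {X : Fin N → Type u} {Y : Fin N → Type v}
    [∀ j, Fintype (X j)] [∀ j, Fintype (Y j)] (W : ∀ j, Channel (X j) (Y j)) {n : Fin M → ℕ}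
    (h : IsGroupSeq N n) (hC : UsesPositive n fun j => (W j).capacity) :
    AchievableAt M W (trafficShare n fun j => (W j).capacity)
      (rate n fun j => (W j).capacity) := by
  obtain ⟨P, hP⟩ := exists_pattern h
  have hT := codedTraffic_pos h hC
  have hpos : ∀ j, 0 < (W j).capacity ∨ Fintype.card (P.Item j) = 0 := by
    intro j
    rcases filter_mem_group_eq h.1 j with he | ⟨ℓ, hℓ, -⟩
    · right; rw [hP, he, Finset.sum_empty]
    · exact Or.inl (hC ℓ (mem_groupIndices_of_mem_group hℓ) j hℓ)
  rw [codedTraffic_eq] at hT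
  have hA := P.achievableAt (desiredSymbols_pos h) W hpos (by simp only [hP]; exact hT.ne')
  simp only [hP, ← codedTraffic_eq] at hA
  rw [show trafficShare n (fun j => (W j).capacity) = _ from funext (trafficShare_eq n _)]
  exact hA

end NPIR

theorem theorem2 {M N : ℕ} [NeZero M] {X : Fin N → Type*} {Y : Fin N → Type*}
    [∀ n, Fintype (X n)] [∀ n, Fintype (Y n)] (W : ∀ n, NPIR.Channel (X n) (Y n)) :
    (∀ n : Fin M → ℕ, NPIR.IsGroupSeq N n →
      NPIR.UsesPositive n (fun j => (W j).capacity) →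
        NPIR.trafficShare n (fun j => (W j).capacity) ∈ stdSimplex ℝ (Fin N) ∧
        NPIR.AchievableAt M W (NPIR.trafficShare n (fun j => (W j).capacity))
          (NPIR.rate n (fun j => (W j).capacity))) ∧
    NPIR.maxRate M (fun j => (W j).capacity) ≤ NPIR.pirCapacity M W := by
  have key : ∀ n : Fin M → ℕ, NPIR.IsGroupSeq N n →
      NPIR.UsesPositive n (fun j => (W j).capacity) →
        NPIR.trafficShare n (fun j => (W j).capacity) ∈ stdSimplex ℝ (Fin N) ∧
        NPIR.AchievableAt M W (NPIR.trafficShare n (fun j => (W j).capacity))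
          (NPIR.rate n (fun j => (W j).capacity)) := fun n hn hC =>
    ⟨NPIR.trafficShare_mem_stdSimplex hn hC, NPIR.achievableAt_rate W hn hC⟩
  refine ⟨key, iSup₂_le fun n hn => ?_⟩
  obtain ⟨hτ, hR⟩ := key n hn.1 hn.2
  exact le_iSup₂_of_le _ hτ (le_iSup₂_of_le _ hR le_rfl)
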